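/- Let $0<q<1$. Write $(a;q)_n=\prod_{k=0}^{n-1}(1-aq^k)$, $(a;q)_\infty=\prod_{k\ge 0}(1-aq^k)$, $\Gamma_q(x)=(1-q)^{1-x}\,\dfrac{(q;q)_\infty}{(q^x;q)_\infty}$ (so that $\Gamma_{q^2}$ is the $q$-gamma function with base $q^2$), and $(a)_n=a(a+1)\cdots(a+n-1)$. Put \[P_1(n)=q^{4n} + 9 q^{2n+1} + 36 q^{4n+2} - 7 q^{6n+1} + 84 q^{6n+3} - 63 q^{8n+2} + 126 q^{8n+4} - 231 q^{10n+3} + 126 q^{10n+5} + 35 q^{12n+2} - 448 q^{12n+4} + 84 q^{12n+6} + 187 q^{14n+3} - 560 q^{14n+5} + 36 q^{14n+7} - 9 q^{16n+2} + 509 q^{16n+4} - 441 q^{16n+6} + 9 q^{16n+8} - 65 q^{18n+3} + 805 q^{18n+5} - 225 q^{18n+7} + q^{18n+9} + q^{20n+2} - 225 q^{20n+4} + 805 q^{20n+6} - 65 q^{20n+8} + 9 q^{22n+3} - 441 q^{22n+5} + 509 q^{22n+7} - 9 q^{22n+9} + 36 q^{24n+4} - 560 q^{24n+6} + 187 q^{24n+8}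 + 84 q^{26n+5} - 448 q^{26n+7} + 35 q^{26n+9} + 126 q^{28n+6} - 231 q^{28n+8} + 126 q^{30n+7} - 63 q^{30n+9} + 84 q^{32n+8} - 7 q^{32n+10} + 36 q^{34n+9} + q^{34n+11} + 9 q^{36n+10} + q^{38n+11} + 1\] \[P_2(n)=q^{2n} + q^{4n} + 5 q^{2n+1} - 5 q^{4n+1} + 10 q^{4n+2} - 5 q^{6n+1} - 16 q^{6n+2} + 10 q^{6n+3} - q^{8n+1} - 11 q^{8n+2} - 25 q^{8n+3} + 5 q^{8n+4} + 19 q^{10n+2} - 14 q^{10n+3} - 15 q^{10n+4} + q^{10n+5} + q^{12n+2} + 46 q^{12n+3} - 4 q^{12n+4} - 4 q^{12n+5} - 4 q^{14n+2} - 4 q^{14n+3} + 46 q^{14n+4} + q^{14n+5} + q^{16n+2} - 15 q^{16n+3} - 14 q^{16n+4} + 19 q^{16n+5} + 5 q^{18n+3} - 25 q^{18n+4} - 11 q^{18n+5} - q^{18n+6} + 10 q^{20n+4} - 16 q^{20n+5} - 5 q^{20n+6} + 10 q^{22n+5} - 5 q^{22n+6} + q^{22n+7} + 5 q^{24n+6}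 + q^{24n+7} + q^{26n+7} + 1\] Then both of the following series converge (absolutely), with the stated sums: \[\sum_{n\geq 0} A_n(q)= \frac{(1-q^2)^4}{\Gamma_{q^2}(1/2)^8},\qquad A_n(q)=\frac{q^{4 n^2}P_1(n)\, (q^2;q^2)_{4 n}\, (q;q^2)_n^{16}}{(q^{4 n}+1) (q^{2 n+1}+1)^9 (q^2;q^2)_{2 n}^{10}},\] \[\sum_{n\geq 0} B_n(q)= \frac{(1-q^2)^4}{\Gamma_{q^2}(1/2)^8},\qquad B_n(q)=\frac{(-1)^n q^{n^2} P_2(n)\, (q;q^2)_{2 n}\, (q^2;q^2)_{3 n}\, (q;q^2)_n^{10}}{(q^{2 n}-q^n+1) (q^{2 n}+q^n+1) (q^{2 n+1}+1)^5 (q^2;q^2)_n^5 (q^2;q^2)_{2 n}^5}.\] They are $q$-analogues of the series of Cullen and of Zhao, \[\sum_{n\geq 0} \Big(\frac{1}{2^{12}}\Big)^n \frac{(\frac12)_n^7 (\frac14)_n(\frac34)_n}{(1)_n^9}(43680 n^4+20632 n^3+4340 n^2+466 n+21)=\frac{2048}{\pi ^4},\] \[\sum_{n\geq 0} \Big(-\frac{3^3}{2^8}\Big)^n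 \frac{(\frac12)_n^5 (\frac14)_n(\frac34)_n(\frac13)_n(\frac23)_n}{(1)_n^9}(4528 n^4+3180 n^3+972 n^2+147 n+9)=\frac{768}{\pi ^4},\] in the following sense (these two classical evaluations are known and are recalled, not asserted). If $a_n$ and $b_n$ denote the $n$-th summands of these two series, then for every $n\ge 0$, as $q\to 1^-$, \[\frac{A_n(q)}{(1-q^2)^4}\to\frac{a_n}{2048},\qquad \frac{B_n(q)}{(1-q^2)^4}\to\frac{b_n}{768},\] while the common right-hand side divided by $(1-q^2)^4$ tends to $\dfrac1{\pi^4}$. -/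

import Mathlib

open Filter Topology

/-- The finite `q`-shifted factorial `(a; q)_n = (1 - a)(1 - a q) ⋯ (1 - a q^(n-1))`. -/
noncomputable def qPoch (a q : ℝ) (n : ℕ) : ℝ :=
  ∏ k ∈ Finset.range n, (1 - a * q ^ k)

/-- The infinite `q`-shifted factorial `(a; q)_∞ = ∏_{k ≥ 0} (1 - a q^k)`. -/
noncomputable def qPochInf (a q : ℝ) : ℝ :=
  ∏' k : ℕ, (1 - a * q ^ k)

/-- The product defining `(a; q)_∞` converges for `|q| < 1`. -/
theorem multipliable_qPochInf (a : ℝ) {q : ℝ} (hq : |q| < 1) :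
    Multipliable fun k : ℕ => 1 - a * q ^ k := by
  have h : Summable fun k : ℕ => -(a * q ^ k) :=
    ((summable_geometric_of_abs_lt_one hq).mul_left a).neg
  simpa [sub_eq_add_neg] using Real.multipliable_one_add_of_summable h

/-- The `q`-gamma function `Γ_q(x) = (1 - q)^(1 - x) (q; q)_∞ / (q^x; q)_∞`, for `0 < q < 1`
and real `x`. -/
noncomputable def qGamma (q x : ℝ) : ℝ :=
  (1 - q) ^ (1 - x) * qPochInf q q / qPochInf (q ^ x) q

/-- The rising factorial `(a)_n = a (a + 1) ⋯ (a + n - 1)`. -/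
noncomputable def risingFac (a : ℝ) (n : ℕ) : ℝ :=
  (ascPochhammer ℝ n).eval a

/-- The polynomial factor `P₁(n)` of the `q`-analogue of Cullen's series. -/
noncomputable def cullenPoly (q : ℝ) (n : ℕ) : ℝ :=
  q ^ (4 * n) + 9 * q ^ (2 * n + 1) + 36 * q ^ (4 * n + 2) - 7 * q ^ (6 * n + 1) +
    84 * q ^ (6 * n + 3) - 63 * q ^ (8 * n + 2) + 126 * q ^ (8 * n + 4) -
    231 * q ^ (10 * n + 3) + 126 * q ^ (10 * n + 5) + 35 * q ^ (12 * n + 2) -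
    448 * q ^ (12 * n + 4) + 84 * q ^ (12 * n + 6) + 187 * q ^ (14 * n + 3) -
    560 * q ^ (14 * n + 5) + 36 * q ^ (14 * n + 7) - 9 * q ^ (16 * n + 2) +
    509 * q ^ (16 * n + 4) - 441 * q ^ (16 * n + 6) + 9 * q ^ (16 * n + 8) -
    65 * q ^ (18 * n + 3) + 805 * q ^ (18 * n + 5) - 225 * q ^ (18 * n + 7) +
    q ^ (18 * n + 9) + q ^ (20 * n + 2) - 225 * q ^ (20 * n + 4) + 805 * q ^ (20 * n + 6) -
    65 * q ^ (20 * n + 8) + 9 * q ^ (22 * n + 3) - 441 * q ^ (22 * n + 5) +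
    509 * q ^ (22 * n + 7) - 9 * q ^ (22 * n + 9) + 36 * q ^ (24 * n + 4) -
    560 * q ^ (24 * n + 6) + 187 * q ^ (24 * n + 8) + 84 * q ^ (26 * n + 5) -
    448 * q ^ (26 * n + 7) + 35 * q ^ (26 * n + 9) + 126 * q ^ (28 * n + 6) -
    231 * q ^ (28 * n + 8) + 126 * q ^ (30 * n + 7) - 63 * q ^ (30 * n + 9) +
    84 * q ^ (32 * n + 8) - 7 * q ^ (32 * n + 10) + 36 * q ^ (34 * n + 9) +
    q ^ (34 * n + 11) + 9 * q ^ (36 * n + 10) + q ^ (38 * n + 11) + 1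

/-- The polynomial factor `P₂(n)` of the `q`-analogue of Zhao's series. -/
noncomputable def zhaoPoly (q : ℝ) (n : ℕ) : ℝ :=
  q ^ (2 * n) + q ^ (4 * n) + 5 * q ^ (2 * n + 1) - 5 * q ^ (4 * n + 1) +
    10 * q ^ (4 * n + 2) - 5 * q ^ (6 * n + 1) - 16 * q ^ (6 * n + 2) +
    10 * q ^ (6 * n + 3) - q ^ (8 * n + 1) - 11 * q ^ (8 * n + 2) - 25 * q ^ (8 * n + 3) +
    5 * q ^ (8 * n + 4) + 19 * q ^ (10 * n + 2) - 14 * q ^ (10 * n + 3) -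
    15 * q ^ (10 * n + 4) + q ^ (10 * n + 5) + q ^ (12 * n + 2) + 46 * q ^ (12 * n + 3) -
    4 * q ^ (12 * n + 4) - 4 * q ^ (12 * n + 5) - 4 * q ^ (14 * n + 2) -
    4 * q ^ (14 * n + 3) + 46 * q ^ (14 * n + 4) + q ^ (14 * n + 5) + q ^ (16 * n + 2) -
    15 * q ^ (16 * n + 3) - 14 * q ^ (16 * n + 4) + 19 * q ^ (16 * n + 5) +
    5 * q ^ (18 * n + 3) - 25 * q ^ (18 * n + 4) - 11 * q ^ (18 * n + 5) -
    q ^ (18 * n + 6) + 10 * q ^ (20 * n + 4) - 16 * q ^ (20 * n + 5) -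
    5 * q ^ (20 * n + 6) + 10 * q ^ (22 * n + 5) - 5 * q ^ (22 * n + 6) + q ^ (22 * n + 7) +
    5 * q ^ (24 * n + 6) + q ^ (24 * n + 7) + q ^ (26 * n + 7) + 1

/-- The `n`-th term of the `q`-analogue of Cullen's series. -/
noncomputable def cullenQTerm (q : ℝ) (n : ℕ) : ℝ :=
  q ^ (4 * n ^ 2) * cullenPoly q n * qPoch (q ^ 2) (q ^ 2) (4 * n) * qPoch q (q ^ 2) n ^ 16 /
    ((q ^ (4 * n) + 1) * (q ^ (2 * n + 1) + 1) ^ 9 * qPoch (q ^ 2) (q ^ 2) (2 * n) ^ 10)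

/-- The `n`-th term of the `q`-analogue of Zhao's series. -/
noncomputable def zhaoQTerm (q : ℝ) (n : ℕ) : ℝ :=
  (-1) ^ n * q ^ (n ^ 2) * zhaoPoly q n * qPoch q (q ^ 2) (2 * n) *
      qPoch (q ^ 2) (q ^ 2) (3 * n) * qPoch q (q ^ 2) n ^ 10 /
    ((q ^ (2 * n) - q ^ n + 1) * (q ^ (2 * n) + q ^ n + 1) * (q ^ (2 * n + 1) + 1) ^ 5 *
      qPoch (q ^ 2) (q ^ 2) n ^ 5 * qPoch (q ^ 2) (q ^ 2) (2 * n) ^ 5)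

/-- The `n`-th term of Cullen's series, whose sum is `2048 / π ^ 4`. -/
noncomputable def cullenTerm (n : ℕ) : ℝ :=
  (1 / 2 ^ 12) ^ n *
    (risingFac (1 / 2) n ^ 7 * risingFac (1 / 4) n * risingFac (3 / 4) n / risingFac 1 n ^ 9) *
    (43680 * n ^ 4 + 20632 * n ^ 3 + 4340 * n ^ 2 + 466 * n + 21)

/-- The `n`-th term of Zhao's series, whose sum is `768 / π ^ 4`. -/
noncomputable def zhaoTerm (n : ℕ) : ℝ :=
  (-(3 ^ 3 / 2 ^ 8)) ^ n *
    (risingFac (1 / 2) n ^ 5 * risingFac (1 / 4) n * risingFac (3 / 4) n *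
      risingFac (1 / 3) n * risingFac (2 / 3) n / risingFac 1 n ^ 9) *
    (4528 * n ^ 4 + 3180 * n ^ 3 + 972 * n ^ 2 + 147 * n + 9)

/-!
Both series arise from a closed 1-form on the grid `ℕ × ℕ`: values `H a b` on the edges from
`(a, b)` to `(a + 1, b)` and `V a b` on those from `(a, b)` to `(a, b + 1)` such that
`H a b + V (a + 1) b = V a b + H a (b + 1)`. The staircase along the diagonal from `(0, 0)` to
`(N, N)` has the partial sum of the series as its total, and so has the path along the axis, where
`H` vanishes, and up the column `a = N`. As `N → ∞` every edge of this column but the first is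
exponentially small, and the first one tends to the eighth power of `(q; q²)_∞ / (q²; q²)_∞`. This
is the right-hand side, since `Γ_{q²}(1/2)² = (1 - q²) ((q²; q²)_∞ / (q; q²)_∞)²`.

As `q → 1⁻`, the summands converge factor by factor. For the right-hand side, log-concavity of
`j ↦ 1 - q ^ j` traps `((q; q²)_∞ / (q²; q²)_∞)²` between finite products whose limits are the two
bounds in Wallis' approximation of `1 / π`.
-/

section Staircase

theorem sum_range_staircase {E : Type*} [AddCommGroup E] {H V : ℕ → ℕ → E}
    (hH : ∀ a, H a 0 = 0)
    (hclosed : ∀ a b, b < a → H a (b + 1) - H a b = V (a + 1) b - V a b) (N : ℕ) :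
    ∑ n ∈ Finset.range N, (H n n + V (n + 1) n) = ∑ b ∈ Finset.range N, V N b := by
  induction N with
  | zero => rfl
  | succ N ih =>
    have hrow : H N N = ∑ b ∈ Finset.range N, V (N + 1) b - ∑ b ∈ Finset.range N, V N b := by
      rw [← Finset.sum_sub_distrib, ← Finset.sum_congr rfl fun b hb =>
        hclosed N b (Finset.mem_range.1 hb), Finset.sum_range_sub, hH, sub_zero]
    rw [Finset.sum_range_succ, Finset.sum_range_succ, ih, hrow]
    abel

theorem tendsto_sum_range_of_norm_le_pow {E : Type*} [SeminormedAddCommGroup E] {V : ℕ → ℕ → E}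
    {K r : ℝ} {L : E} (hr₀ : 0 ≤ r) (hr₁ : r < 1)
    (hV : ∀ N b, 0 < b → b < N → ‖V N b‖ ≤ K * r ^ N)
    (hL : Tendsto (fun N => V N 0) atTop (𝓝 L)) :
    Tendsto (fun N => ∑ b ∈ Finset.range N, V N b) atTop (𝓝 L) := by
  rw [← tendsto_add_atTop_iff_nat 1]
  simp only [Finset.sum_range_succ']
  have htail : Tendsto (fun N => ∑ b ∈ Finset.range N, V (N + 1) (b + 1)) atTop (𝓝 0) := by
    have hbound : Tendsto (fun N : ℕ => K * r * (N * r ^ N)) atTop (𝓝 0) := by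
      simpa using (tendsto_self_mul_const_pow_of_lt_one hr₀ hr₁).const_mul (K * r)
    refine squeeze_zero_norm (fun N => ?_) hbound
    calc ‖∑ b ∈ Finset.range N, V (N + 1) (b + 1)‖
        ≤ ∑ _ ∈ Finset.range N, K * r ^ (N + 1) :=
          norm_sum_le_of_le _ fun _ hb =>
            hV _ _ (Nat.succ_pos _) (Nat.succ_lt_succ (Finset.mem_range.1 hb))
      _ = K * r * (N * r ^ N) := by
          rw [Finset.sum_const, Finset.card_range, nsmul_eq_mul]; ring
  simpa using htail.add ((tendsto_add_atTop_iff_nat 1).2 hL)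

theorem hasSum_staircase {E : Type*} [NormedAddCommGroup E] [CompleteSpace E] {H V : ℕ → ℕ → E}
    {K r : ℝ} {L : E} (hr₀ : 0 ≤ r) (hr₁ : r < 1) (hH : ∀ a, H a 0 = 0)
    (hclosed : ∀ a b, b < a → H a (b + 1) - H a b = V (a + 1) b - V a b)
    (hdiag : Summable fun n => H n n)
    (hV : ∀ N b, 0 < b → b < N → ‖V N b‖ ≤ K * r ^ N)
    (hL : Tendsto (fun N => V N 0) atTop (𝓝 L)) :
    HasSum (fun n => H n n + V (n + 1) n) L := by
  have hsubdiag : Summable fun n => V (n + 1) n := by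
    rw [← summable_nat_add_iff 1]
    refine Summable.of_norm_bounded
      (((summable_nat_add_iff 2).2 (summable_geometric_of_lt_one hr₀ hr₁)).mul_left K) fun n => ?_
    exact hV (n + 2) (n + 1) n.succ_pos (Nat.lt_succ_self _)
  rw [(hdiag.add hsubdiag).hasSum_iff_tendsto_nat]
  simpa only [sum_range_staircase hH hclosed] using
    tendsto_sum_range_of_norm_le_pow hr₀ hr₁ hV hL

end Staircase

theorem tendsto_of_forall_eventually_mem_Icc {α β ι : Type*} [TopologicalSpace α] [LinearOrder α]
    [OrderTopology α] {l : Filter β} {p : Filter ι} [p.NeBot] {f : β → α} {lo up : ι → β → α}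
    {lo' up' : ι → α} {L : α} (hf : ∀ n, ∀ᶠ x in l, f x ∈ Set.Icc (lo n x) (up n x))
    (hlo : ∀ n, Tendsto (lo n) l (𝓝 (lo' n))) (hup : ∀ n, Tendsto (up n) l (𝓝 (up' n)))
    (hlo' : Tendsto lo' p (𝓝 L)) (hup' : Tendsto up' p (𝓝 L)) : Tendsto f l (𝓝 L) := by
  refine tendsto_order.2 ⟨fun a ha => ?_, fun a ha => ?_⟩
  · obtain ⟨n, hn⟩ := (hlo'.eventually_const_lt ha).exists
    filter_upwards [hf n, (hlo n).eventually_const_lt hn] with x hx hlt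
    exact hlt.trans_le hx.1
  · obtain ⟨n, hn⟩ := (hup'.eventually_lt_const ha).exists
    filter_upwards [hf n, (hup n).eventually_lt_const hn] with x hx hlt
    exact hx.2.trans_lt hlt

section QPochhammer

theorem qPoch_zero (a q : ℝ) : qPoch a q 0 = 1 := Finset.prod_range_zero _

theorem qPoch_succ (a q : ℝ) (n : ℕ) : qPoch a q (n + 1) = qPoch a q n * (1 - a * q ^ n) :=
  Finset.prod_range_succ _ _

variable {a q : ℝ}

theorem one_sub_mul_pow_pos (ha : a < 1) (hq₀ : 0 ≤ q) (hq₁ : q ≤ 1) (n : ℕ) :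
    0 < 1 - a * q ^ n := by
  have hpow₀ : 0 ≤ q ^ n := pow_nonneg hq₀ n
  have hpow₁ : q ^ n ≤ 1 := pow_le_one₀ hq₀ hq₁
  rcases hpow₁.lt_or_eq with h | h <;> nlinarith

theorem qPoch_pos (ha : a < 1) (hq₀ : 0 ≤ q) (hq₁ : q ≤ 1) (n : ℕ) : 0 < qPoch a q n :=
  Finset.prod_pos fun k _ => one_sub_mul_pow_pos ha hq₀ hq₁ k

theorem qPoch_antitone (ha₀ : 0 ≤ a) (ha₁ : a < 1) (hq₀ : 0 ≤ q) (hq₁ : q ≤ 1) :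
    Antitone (qPoch a q) := by
  refine antitone_nat_of_succ_le fun n => ?_
  rw [qPoch_succ]
  exact mul_le_of_le_one_right (qPoch_pos ha₁ hq₀ hq₁ n).le
    (sub_le_self _ (mul_nonneg ha₀ (pow_nonneg hq₀ n)))

theorem qPoch_le_one (ha₀ : 0 ≤ a) (ha₁ : a < 1) (hq₀ : 0 ≤ q) (hq₁ : q ≤ 1) (n : ℕ) :
    qPoch a q n ≤ 1 :=
  (qPoch_antitone ha₀ ha₁ hq₀ hq₁ n.zero_le).trans_eq (qPoch_zero a q)

theorem tendsto_qPoch (a : ℝ) (hq : |q| < 1) :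
    Tendsto (qPoch a q) atTop (𝓝 (qPochInf a q)) :=
  (multipliable_qPochInf a hq).hasProd.tendsto_prod_nat

theorem qPochInf_pos (ha : a < 1) (hq₀ : 0 ≤ q) (hq₁ : q < 1) : 0 < qPochInf a q := by
  have hsum : Summable fun k : ℕ => -(a * q ^ k) :=
    ((summable_geometric_of_lt_one hq₀ hq₁).mul_left a).neg
  have hexp := Real.rexp_tsum_eq_tprod (f := fun k : ℕ => 1 - a * q ^ k)
    (one_sub_mul_pow_pos ha hq₀ hq₁.le)
    (by simpa only [sub_eq_add_neg] using Real.summable_log_one_add_of_summable hsum)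
  exact (Real.exp_pos _).trans_eq hexp

theorem qPochInf_le_qPoch (ha₀ : 0 ≤ a) (ha₁ : a < 1) (hq₀ : 0 ≤ q) (hq₁ : q < 1) (n : ℕ) :
    qPochInf a q ≤ qPoch a q n :=
  (qPoch_antitone ha₀ ha₁ hq₀ hq₁.le).le_of_tendsto
    (tendsto_qPoch a (by rwa [abs_of_nonneg hq₀])) n

end QPochhammer

section QWallis

variable {q : ℝ}

theorem sq_mem_Ioo (hq : q ∈ Set.Ioo (0 : ℝ) 1) : q ^ 2 ∈ Set.Ioo (0 : ℝ) 1 :=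
  ⟨pow_pos hq.1 2, pow_lt_one₀ hq.1.le hq.2 two_ne_zero⟩

theorem one_sub_pow_pos (hq : q ∈ Set.Ioo (0 : ℝ) 1) {n : ℕ} (hn : n ≠ 0) : 0 < 1 - q ^ n :=
  sub_pos.2 (pow_lt_one₀ hq.1.le hq.2 hn)

theorem pow_mem_Icc (hq : q ∈ Set.Ioo (0 : ℝ) 1) (n : ℕ) : q ^ n ∈ Set.Icc (0 : ℝ) 1 :=
  ⟨pow_nonneg hq.1.le n, pow_le_one₀ hq.1.le hq.2.le⟩

theorem tendsto_pow_two_mul_atTop (hq : q ∈ Set.Ioo (0 : ℝ) 1) :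
    Tendsto (fun n : ℕ => q ^ (2 * n)) atTop (𝓝 0) := by
  simp only [pow_mul]
  exact tendsto_pow_atTop_nhds_zero_of_lt_one (sq_mem_Ioo hq).1.le (sq_mem_Ioo hq).2

theorem qPoch_odd_pos (hq : q ∈ Set.Ioo (0 : ℝ) 1) (n : ℕ) : 0 < qPoch q (q ^ 2) n :=
  qPoch_pos hq.2 (sq_mem_Ioo hq).1.le (sq_mem_Ioo hq).2.le n

theorem qPoch_even_pos (hq : q ∈ Set.Ioo (0 : ℝ) 1) (n : ℕ) : 0 < qPoch (q ^ 2) (q ^ 2) n :=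
  qPoch_pos (sq_mem_Ioo hq).2 (sq_mem_Ioo hq).1.le (sq_mem_Ioo hq).2.le n

theorem qPoch_odd_le_one (hq : q ∈ Set.Ioo (0 : ℝ) 1) (n : ℕ) : qPoch q (q ^ 2) n ≤ 1 :=
  qPoch_le_one hq.1.le hq.2 (sq_mem_Ioo hq).1.le (sq_mem_Ioo hq).2.le n

theorem qPoch_even_le_one (hq : q ∈ Set.Ioo (0 : ℝ) 1) (n : ℕ) : qPoch (q ^ 2) (q ^ 2) n ≤ 1 :=
  qPoch_le_one (sq_mem_Ioo hq).1.le (sq_mem_Ioo hq).2 (sq_mem_Ioo hq).1.le (sq_mem_Ioo hq).2.le n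

theorem qPochInf_even_pos (hq : q ∈ Set.Ioo (0 : ℝ) 1) : 0 < qPochInf (q ^ 2) (q ^ 2) :=
  qPochInf_pos (sq_mem_Ioo hq).2 (sq_mem_Ioo hq).1.le (sq_mem_Ioo hq).2

theorem qPochInf_even_le (hq : q ∈ Set.Ioo (0 : ℝ) 1) (n : ℕ) :
    qPochInf (q ^ 2) (q ^ 2) ≤ qPoch (q ^ 2) (q ^ 2) n :=
  qPochInf_le_qPoch (sq_mem_Ioo hq).1.le (sq_mem_Ioo hq).2 (sq_mem_Ioo hq).1.le (sq_mem_Ioo hq).2 n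

/-- The ratio `(q; q²)_n / (q²; q²)_n`, a `q`-analogue of the Wallis ratio `(1/2)_n / n!`. -/
noncomputable def qWallis (q : ℝ) (n : ℕ) : ℝ :=
  qPoch q (q ^ 2) n / qPoch (q ^ 2) (q ^ 2) n

/-- The limit `(q; q²)_∞ / (q²; q²)_∞` of the `q`-Wallis ratios. -/
noncomputable def qWallisInf (q : ℝ) : ℝ :=
  qPochInf q (q ^ 2) / qPochInf (q ^ 2) (q ^ 2)

theorem tendsto_qWallis (hq : q ∈ Set.Ioo (0 : ℝ) 1) :
    Tendsto (qWallis q) atTop (𝓝 (qWallisInf q)) := by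
  have hQ : |q ^ 2| < 1 := by rw [abs_of_pos (sq_mem_Ioo hq).1]; exact (sq_mem_Ioo hq).2
  exact (tendsto_qPoch q hQ).div (tendsto_qPoch (q ^ 2) hQ) (qPochInf_even_pos hq).ne'

theorem qGamma_sq_one_half_sq (hq : q ∈ Set.Ioo (0 : ℝ) 1) :
    qGamma (q ^ 2) (1 / 2) ^ 2 = (1 - q ^ 2) / qWallisInf q ^ 2 := by
  have hbase : ((q ^ 2) ^ (1 / 2 : ℝ)) = q := by rw [← Real.sqrt_eq_rpow, Real.sqrt_sq hq.1.le]
  have hfactor : ((1 - q ^ 2) ^ (1 - 1 / 2 : ℝ)) ^ 2 = 1 - q ^ 2 := by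
    rw [sub_half, ← Real.sqrt_eq_rpow, Real.sq_sqrt (one_sub_pow_pos hq two_ne_zero).le]
  rw [qGamma, qWallisInf, hbase, mul_div_assoc, mul_pow, hfactor, ← inv_div, inv_pow,
    ← div_eq_mul_inv]

theorem one_sub_sq_pow_four_div_qGamma_pow_eight (hq : q ∈ Set.Ioo (0 : ℝ) 1) :
    (1 - q ^ 2) ^ 4 / qGamma (q ^ 2) (1 / 2) ^ 8 = qWallisInf q ^ 8 := by
  have hne := (one_sub_pow_pos hq two_ne_zero).ne'
  rw [pow_mul (qGamma _ _) 2 4, qGamma_sq_one_half_sq hq, div_pow,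
    div_div_cancel₀ (pow_ne_zero 4 hne), ← pow_mul]

end QWallis

section CullenForm

section RationalFunctions

/-- The polynomial `Θ(U, W)` in the closed form behind Cullen's series. -/
def cullenTheta {R : Type*} [CommRing R] (U W : R) : R :=
  U ^ 2 * W ^ 2 + U ^ 2 * W + U * W ^ 2 - 6 * U * W + U + W + 1

variable {F : Type*} [Field F]

/-- The rational factor of `cullenForm`, with `A` and `B` standing for `q ^ (2 * a)` and
`q ^ (2 * b)`. -/
def cullenRat (q A B : F) : F :=
  (1 - B ^ 2) * (1 - q * A ^ 2 * B) * cullenTheta (A * B) (q * A) / ((1 + A * B) * (1 + q * A))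

/-- The ratio of the values of `cullenKernel` at `(a, b + 1)` and `(a, b)`, as a function of
`A = q ^ (2 * a)` and `B = q ^ (2 * b)`. -/
def cullenKernelRatio (q A B : F) : F :=
  A ^ 2 * (1 - q ^ 2 * A ^ 2 * B ^ 2) * (1 - q ^ 4 * A ^ 2 * B ^ 2) * (1 - q * B) ^ 8 /
    ((1 - q ^ 2 * B ^ 2) * (1 - q ^ 4 * B ^ 2) * (1 - q ^ 2 * A * B) ^ 8)

/-- The quotient of `cullenForm q a (b + 1)` by `cullenKernel q a b`, as a function of
`A = q ^ (2 * a)` and `B = q ^ (2 * b)`. -/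
def cullenShiftRat (q A B : F) : F :=
  A ^ 2 * (1 - q ^ 2 * A ^ 2 * B ^ 2) * (1 - q * B) ^ 7 * (1 - q ^ 3 * A ^ 2 * B) *
      cullenTheta (q ^ 2 * A * B) (q * A) /
    ((1 - q ^ 2 * A * B) ^ 7 * (1 + q * A) * (1 + q * B))

variable {q A B : F}

theorem cullenRat_mul_cullenKernelRatio (hB : 1 - q * B ≠ 0) (hB' : 1 - q ^ 4 * B ^ 2 ≠ 0)
    (hAB : 1 - q ^ 2 * A * B ≠ 0) (hAB' : 1 + q ^ 2 * A * B ≠ 0) :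
    cullenRat q A (q ^ 2 * B) * cullenKernelRatio q A B = cullenShiftRat q A B := by
  unfold cullenRat cullenKernelRatio cullenShiftRat
  rw [show 1 - q ^ 2 * B ^ 2 = (1 - q * B) * (1 + q * B) by ring,
    show 1 - q ^ 4 * A ^ 2 * B ^ 2 = (1 - q ^ 2 * A * B) * (1 + q ^ 2 * A * B) by ring,
    show 1 - (q ^ 2 * B) ^ 2 = 1 - q ^ 4 * B ^ 2 by ring,
    show A * (q ^ 2 * B) = q ^ 2 * A * B by ring,
    show 1 - q * A ^ 2 * (q ^ 2 * B) = 1 - q ^ 3 * A ^ 2 * B by ring]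
  generalize 1 - q ^ 4 * B ^ 2 = y₁ at *
  generalize 1 - q ^ 2 * A * B = y₂ at *
  generalize 1 + q ^ 2 * A * B = y₃ at *
  generalize 1 - q * B = y₄ at *
  field_simp

theorem cullenTheta_identity {R : Type*} [CommRing R] (q A B : R) :
    (A ^ 2 * (1 - q ^ 2 * A ^ 2 * B ^ 2) * (1 - q * B) ^ 7 * (1 - q ^ 3 * A ^ 2 * B) *
          cullenTheta (q ^ 2 * A * B) (q * A) -
        B ^ 2 * (1 - q ^ 2 * B ^ 2 * A ^ 2) * (1 - q * A) ^ 7 * (1 - q ^ 3 * B ^ 2 * A) *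
          cullenTheta (q ^ 2 * B * A) (q * B)) * (1 + A * B) =
      ((1 - B ^ 2) * (1 - q * A ^ 2 * B) * cullenTheta (A * B) (q * A) * (1 + q * B) -
        (1 - A ^ 2) * (1 - q * B ^ 2 * A) * cullenTheta (B * A) (q * B) * (1 + q * A)) *
      (1 - q ^ 2 * A * B) ^ 7 := by
  unfold cullenTheta
  ring

theorem cullenShiftRat_sub_cullenRat_comm (hA : 1 + q * A ≠ 0) (hB : 1 + q * B ≠ 0)
    (hAB : 1 + A * B ≠ 0) (hAB' : 1 - q ^ 2 * A * B ≠ 0) :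
    cullenShiftRat q A B - cullenRat q A B = cullenShiftRat q B A - cullenRat q B A := by
  have hcross := (div_eq_div_iff (pow_ne_zero 7 hAB') hAB).2 (cullenTheta_identity q A B)
  unfold cullenShiftRat cullenRat
  rw [mul_right_comm (_ ^ 7) (1 + q * B), mul_right_comm (q ^ 2) B A, mul_comm B A]
  rw [mul_right_comm (q ^ 2) B A, mul_comm B A] at hcross
  rw [sub_eq_sub_iff_sub_eq_sub, ← sub_div, mul_assoc (_ ^ 7), ← div_div, hcross]
  generalize 1 + q * A = x at *
  generalize 1 + q * B = y at *
  field_simp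

end RationalFunctions

/-- The product underlying `cullenForm`. -/
noncomputable def cullenKernel (q : ℝ) (a b : ℕ) : ℝ :=
  q ^ (4 * a * b) * qPoch (q ^ 2) (q ^ 2) (2 * a + 2 * b) * qPoch q (q ^ 2) a ^ 8 *
      qPoch q (q ^ 2) b ^ 8 /
    (qPoch (q ^ 2) (q ^ 2) (2 * a) * qPoch (q ^ 2) (q ^ 2) (2 * b) *
      qPoch (q ^ 2) (q ^ 2) (a + b) ^ 8)

/-- The closed form on `ℕ × ℕ` behind Cullen's series: `cullenForm q a b` is its value on the edge
from `(a, b)` to `(a + 1, b)`, and `cullenForm q b a` its value on the edge from `(a, b)` to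
`(a, b + 1)`. -/
noncomputable def cullenForm (q : ℝ) (a b : ℕ) : ℝ :=
  cullenRat q (q ^ (2 * a)) (q ^ (2 * b)) * cullenKernel q a b

theorem cullenKernel_comm (q : ℝ) (a b : ℕ) : cullenKernel q a b = cullenKernel q b a := by
  unfold cullenKernel
  rw [mul_right_comm 4 a b, add_comm (2 * a), add_comm a]
  ring

theorem cullenKernel_succ_right (q : ℝ) (a b : ℕ) :
    cullenKernel q a (b + 1) =
      cullenKernel q a b * cullenKernelRatio q (q ^ (2 * a)) (q ^ (2 * b)) := by
  have hpow : q ^ (4 * a * (b + 1)) = q ^ (4 * a * b) * (q ^ (2 * a)) ^ 2 := by ring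
  unfold cullenKernel cullenKernelRatio
  rw [hpow, div_mul_div_comm, mul_add_one 2 b, ← add_assoc, ← add_assoc]
  simp only [qPoch_succ]
  congr 1 <;> ring

variable {q : ℝ}

theorem cullenForm_succ_right (hq : q ∈ Set.Ioo (0 : ℝ) 1) (a b : ℕ) :
    cullenForm q a (b + 1) = cullenShiftRat q (q ^ (2 * a)) (q ^ (2 * b)) * cullenKernel q a b := by
  have hq₀ := hq.1
  have hB : 1 - q * q ^ (2 * b) ≠ 0 := by
    rw [← pow_succ']; exact (one_sub_pow_pos hq (by positivity)).ne'
  have hB' : 1 - q ^ 4 * (q ^ (2 * b)) ^ 2 ≠ 0 := by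
    rw [← pow_mul, ← pow_add]; exact (one_sub_pow_pos hq (by positivity)).ne'
  have hAB : 1 - q ^ 2 * q ^ (2 * a) * q ^ (2 * b) ≠ 0 := by
    rw [← pow_add, ← pow_add]; exact (one_sub_pow_pos hq (by positivity)).ne'
  rw [cullenForm, cullenKernel_succ_right, mul_add_one 2 b, add_comm, pow_add,
    ← cullenRat_mul_cullenKernelRatio hB hB' hAB (by positivity)]
  ring

theorem cullenForm_closed (hq : q ∈ Set.Ioo (0 : ℝ) 1) (a b : ℕ) :
    cullenForm q a (b + 1) - cullenForm q a b = cullenForm q b (a + 1) - cullenForm q b a := by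
  have hq₀ := hq.1
  have hAB : 1 - q ^ 2 * q ^ (2 * a) * q ^ (2 * b) ≠ 0 := by
    rw [← pow_add, ← pow_add]; exact (one_sub_pow_pos hq (by positivity)).ne'
  rw [cullenForm_succ_right hq, cullenForm_succ_right hq, cullenForm, cullenForm,
    cullenKernel_comm q b a, ← sub_mul, ← sub_mul, cullenShiftRat_sub_cullenRat_comm
      (by positivity) (by positivity) (by positivity) hAB]

theorem cullenForm_zero_right (q : ℝ) (a : ℕ) : cullenForm q a 0 = 0 := by
  simp [cullenForm, cullenRat]

theorem cullenPoly_eq (q : ℝ) {n : ℕ} {X : ℝ} (hX : X = q ^ (2 * n)) :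
    cullenPoly q n =
      (1 - X ^ 2) * (1 - q * X ^ 3) * cullenTheta (X ^ 2) (q * X) * (1 + q * X) ^ 8 +
        X ^ 2 * (1 + X ^ 2) * (1 - q ^ 2 * X ^ 4) * (1 - q ^ 3 * X ^ 3) *
          cullenTheta (q ^ 2 * X ^ 2) (q * X) := by
  unfold cullenPoly cullenTheta
  rw [hX]
  ring

theorem cullenRat_add_cullenShiftRat_diag (hq : q ∈ Set.Ioo (0 : ℝ) 1) (n : ℕ) :
    cullenRat q (q ^ (2 * n)) (q ^ (2 * n)) + cullenShiftRat q (q ^ (2 * n)) (q ^ (2 * n)) =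
      cullenPoly q n / ((q ^ (4 * n) + 1) * (q ^ (2 * n + 1) + 1) ^ 9) := by
  have hq₀ := hq.1
  have hX : 1 - q * q ^ (2 * n) ≠ 0 := by
    rw [← pow_succ']; exact (one_sub_pow_pos hq (by positivity)).ne'
  have hX' : 1 + q * q ^ (2 * n) ≠ 0 := by positivity
  have hX'' : 1 + (q ^ (2 * n)) ^ 2 ≠ 0 := by positivity
  rw [cullenPoly_eq q rfl, show q ^ (4 * n) + 1 = 1 + (q ^ (2 * n)) ^ 2 by ring,
    show q ^ (2 * n + 1) + 1 = 1 + q * q ^ (2 * n) by ring]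
  generalize q ^ (2 * n) = X at *
  unfold cullenRat cullenShiftRat
  rw [show 1 - q ^ 2 * X * X = (1 - q * X) * (1 + q * X) by ring, ← sq X,
    show q ^ 2 * X * X = q ^ 2 * X ^ 2 by ring]
  generalize cullenTheta (X ^ 2) (q * X) = t₁
  generalize cullenTheta (q ^ 2 * X ^ 2) (q * X) = t₂
  generalize 1 - q * X = y₁ at *
  generalize 1 + q * X = y₂ at *
  field_simp

theorem cullenQTerm_eq (hq : q ∈ Set.Ioo (0 : ℝ) 1) (n : ℕ) :
    cullenQTerm q n = cullenForm q n n + cullenForm q n (n + 1) := by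
  rw [cullenForm_succ_right hq, cullenForm, ← add_mul, cullenRat_add_cullenShiftRat_diag hq,
    cullenKernel, cullenQTerm, ← two_mul n, show 2 * n + 2 * n = 4 * n by ring,
    mul_assoc 4 n n, ← sq n, div_mul_div_comm]
  congr 1 <;> ring

theorem abs_cullenKernel_le (hq : q ∈ Set.Ioo (0 : ℝ) 1) (a b : ℕ) :
    |cullenKernel q a b| ≤ q ^ (4 * a * b) / qPochInf (q ^ 2) (q ^ 2) ^ 10 := by
  have hq₀ := hq.1
  have hodd := qPoch_odd_pos hq
  have heven := qPoch_even_pos hq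
  have hinf := qPochInf_even_pos hq
  have hle := qPochInf_even_le hq
  rw [cullenKernel, abs_of_nonneg (div_nonneg
    (by have := hodd a; have := hodd b; have := heven (2 * a + 2 * b); positivity)
    (by have := heven (2 * a); have := heven (2 * b); have := heven (a + b); positivity))]
  calc _ ≤ q ^ (4 * a * b) * 1 * 1 ^ 8 * 1 ^ 8 /
        (qPochInf (q ^ 2) (q ^ 2) * qPochInf (q ^ 2) (q ^ 2) * qPochInf (q ^ 2) (q ^ 2) ^ 8) := by
        have := hodd a; have := hodd b
        have := heven (2 * a); have := heven (2 * b); have := heven (2 * a + 2 * b)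
        gcongr
        exacts [qPoch_even_le_one hq _, qPoch_odd_le_one hq _, qPoch_odd_le_one hq _, hle _, hle _,
          hle _]
    _ = _ := by ring

theorem continuousOn_cullenRat (hq : 0 ≤ q) :
    ContinuousOn (fun p : ℝ × ℝ => cullenRat q p.1 p.2) (Set.Icc 0 1 ×ˢ Set.Icc 0 1) := by
  unfold cullenRat cullenTheta
  refine ContinuousOn.div (by fun_prop) (by fun_prop) fun p hp => ?_
  have hA : 0 ≤ p.1 := hp.1.1
  have hB : 0 ≤ p.2 := hp.2.1
  positivity

theorem exists_abs_cullenForm_le (hq : q ∈ Set.Ioo (0 : ℝ) 1) :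
    ∃ K : ℝ, 0 ≤ K ∧ ∀ a b, |cullenForm q a b| ≤ K * q ^ (4 * a * b) := by
  obtain ⟨M, hM⟩ := (isCompact_Icc.prod isCompact_Icc).exists_bound_of_continuousOn
    (continuousOn_cullenRat hq.1.le)
  have hM₀ : 0 ≤ M := (norm_nonneg _).trans (hM (0, 0) (by simp))
  have hinf := qPochInf_even_pos hq
  refine ⟨M / qPochInf (q ^ 2) (q ^ 2) ^ 10, by positivity, fun a b => ?_⟩
  rw [cullenForm, abs_mul, div_mul_eq_mul_div, ← mul_div_assoc']
  exact mul_le_mul (hM (q ^ (2 * a), q ^ (2 * b)) ⟨pow_mem_Icc hq _, pow_mem_Icc hq _⟩)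
    (abs_cullenKernel_le hq a b) (abs_nonneg _) hM₀

theorem cullenKernel_zero_left (hq : q ∈ Set.Ioo (0 : ℝ) 1) (b : ℕ) :
    cullenKernel q 0 b = qWallis q b ^ 8 := by
  have hne := (qPoch_even_pos hq (2 * b)).ne'
  simp only [cullenKernel, qWallis, qPoch_zero, mul_zero, zero_mul, pow_zero, zero_add]
  field_simp

theorem tendsto_cullenForm_zero_left (hq : q ∈ Set.Ioo (0 : ℝ) 1) :
    Tendsto (fun b => cullenForm q 0 b) atTop (𝓝 (qWallisInf q ^ 8)) := by
  have hrat : Tendsto (fun b : ℕ => cullenRat q 1 (q ^ (2 * b))) atTop (𝓝 1) := by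
    have hone : cullenRat q 1 0 = 1 := by
      have hne : 1 + q ≠ 0 := (add_pos one_pos hq.1).ne'
      rw [cullenRat, cullenTheta, div_eq_one_iff_eq (by simpa using hne)]
      ring
    have hcont : Tendsto (cullenRat q 1) (𝓝[Set.Icc 0 1] 0) (𝓝 (cullenRat q 1 0)) :=
      (continuousOn_cullenRat hq.1.le).uncurry_left (f := cullenRat q) 1 (by simp) 0 (by simp)
    rw [hone] at hcont
    exact hcont.comp (tendsto_nhdsWithin_iff.2
      ⟨tendsto_pow_two_mul_atTop hq, Eventually.of_forall fun b => pow_mem_Icc hq _⟩)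
  simpa only [cullenForm, mul_zero, pow_zero, cullenKernel_zero_left hq, one_mul] using
    hrat.mul ((tendsto_qWallis hq).pow 8)

theorem hasSum_cullenQTerm (hq : q ∈ Set.Ioo (0 : ℝ) 1) :
    HasSum (cullenQTerm q) (qWallisInf q ^ 8) := by
  obtain ⟨K, hK, hbound⟩ := exists_abs_cullenForm_le hq
  have hbound' : ∀ {a b m : ℕ}, m ≤ 4 * a * b → |cullenForm q a b| ≤ K * q ^ m := fun h =>
    (hbound _ _).trans
      (mul_le_mul_of_nonneg_left (pow_le_pow_of_le_one hq.1.le hq.2.le h) hK)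
  have hdiag : Summable fun n => cullenForm q n n :=
    Summable.of_norm_bounded ((summable_geometric_of_lt_one hq.1.le hq.2).mul_left K)
      fun n => hbound' (by nlinarith [n.le_mul_self])
  rw [funext (cullenQTerm_eq hq)]
  exact hasSum_staircase (H := cullenForm q) (V := fun a b => cullenForm q b a) hq.1.le hq.2
    (cullenForm_zero_right q) (fun a b _ => cullenForm_closed hq a b) hdiag
    (fun N b hb _ => hbound' (by nlinarith)) (tendsto_cullenForm_zero_left hq)

end CullenForm

section ZhaoForm

section RationalFunctions

variable {F : Type*} [Field F]

/-- The polynomial `κ(A, C)` in the closed form behind Zhao's series. -/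
def zhaoKappa {R : Type*} [CommRing R] (q A C : R) : R :=
  (1 - q * A ^ 2) * (1 - A ^ 2 * C) * (1 - q * A * C) * (1 - q * A) ^ 2 -
    q * (1 - q * A ^ 2 * C) * (1 + q * A) * (1 - A) ^ 3 * (1 - A * C)

/-- The rational factor of `zhaoHor`, with `A` and `C` standing for `q ^ (2 * a)` and
`q ^ (2 * c)`. -/
def zhaoHorRat (q A C : F) : F :=
  (1 - C) * zhaoKappa q A C / ((1 - q) * (1 - A ^ 2 * C) * (1 + q * A))

/-- The rational factor of `zhaoVert`, with `A` and `C` standing for `q ^ (2 * a)` and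
`q ^ (2 * c)`. -/
def zhaoVertRat (q A C : F) : F :=
  (1 - q * A * C ^ 2) * (1 - A ^ 2) * (1 - A) ^ 4 / (1 - A ^ 2 * C)

/-- The ratio of the values of `zhaoKernel` at `(a, c + 1)` and `(a, c)`, as a function of
`A = q ^ (2 * a)` and `C = q ^ (2 * c)`. -/
def zhaoKernelHorRatio (q A C : F) : F :=
  -(A / (q * C)) * (1 - q ^ 2 * A ^ 2 * C) * (1 - q * A * C) * (1 - q * C) ^ 4 /
    ((1 - q ^ 2 * C) * (1 - q ^ 2 * A * C) ^ 4)

/-- The ratio of the values of `zhaoKernel` at `(a + 1, c)` and `(a, c)`, as a function of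
`A = q ^ (2 * a)` and `C = q ^ (2 * c)`. -/
def zhaoKernelVertRatio (q A C : F) : F :=
  C * (1 - q ^ 2 * A ^ 2 * C) * (1 - q ^ 4 * A ^ 2 * C) * (1 - q * A * C) * (1 - q * A) ^ 6 /
    ((1 - q ^ 2 * A ^ 2) * (1 - q ^ 4 * A ^ 2) * (1 - q ^ 2 * A) ^ 4 * (1 - q ^ 2 * A * C) ^ 4)

/-- The rational factor of `zhaoHor q a (c + 1)` relative to `zhaoKernel q a c`, as a function of
`A = q ^ (2 * a)` and `C = q ^ (2 * c)`. -/
def zhaoHorShiftRat (q A C : F) : F :=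
  -(A / (q * C)) * (1 - q * A * C) * (1 - q * C) ^ 4 * zhaoKappa q A (q ^ 2 * C) /
    ((1 - q) * (1 + q * A) * (1 - q ^ 2 * A * C) ^ 4)

/-- The rational factor of `zhaoVert q (a + 1) c` relative to `zhaoKernel q a c`, as a function of
`A = q ^ (2 * a)` and `C = q ^ (2 * c)`. -/
def zhaoVertShiftRat (q A C : F) : F :=
  C * (1 - q ^ 3 * A * C ^ 2) * (1 - q ^ 2 * A ^ 2 * C) * (1 - q * A * C) * (1 - q * A) ^ 5 /
    ((1 + q * A) * (1 - q ^ 2 * A * C) ^ 4)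

variable {q A C : F}

theorem zhaoHorRat_mul_zhaoKernelHorRatio (hC : 1 - q ^ 2 * C ≠ 0)
    (hAC : 1 - q ^ 2 * A ^ 2 * C ≠ 0) :
    zhaoHorRat q A (q ^ 2 * C) * zhaoKernelHorRatio q A C = zhaoHorShiftRat q A C := by
  unfold zhaoHorRat zhaoKernelHorRatio zhaoHorShiftRat
  rw [show A ^ 2 * (q ^ 2 * C) = q ^ 2 * A ^ 2 * C by ring]
  generalize A / (q * C) = z
  generalize 1 - q ^ 2 * C = y₁ at *
  generalize 1 - q ^ 2 * A ^ 2 * C = y₂ at *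
  field_simp

theorem zhaoVertRat_mul_zhaoKernelVertRatio (hA : 1 - q * A ≠ 0) (hA' : 1 - q ^ 2 * A ≠ 0)
    (hA'' : 1 - q ^ 4 * A ^ 2 ≠ 0) (hAC : 1 - q ^ 4 * A ^ 2 * C ≠ 0) :
    zhaoVertRat q (q ^ 2 * A) C * zhaoKernelVertRatio q A C = zhaoVertShiftRat q A C := by
  unfold zhaoVertRat zhaoKernelVertRatio zhaoVertShiftRat
  rw [show (q ^ 2 * A) ^ 2 = q ^ 4 * A ^ 2 by ring,
    show 1 - q ^ 2 * A ^ 2 = (1 - q * A) * (1 + q * A) by ring,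
    show q * (q ^ 2 * A) * C ^ 2 = q ^ 3 * A * C ^ 2 by ring]
  generalize 1 - q * A = y₁ at *
  generalize 1 - q ^ 2 * A = y₂ at *
  generalize 1 - q ^ 4 * A ^ 2 = y₃ at *
  generalize 1 - q ^ 4 * A ^ 2 * C = y₄ at *
  field_simp

theorem zhaoKappa_identity {R : Type*} [CommRing R] (q A C : R) :
    -A * (1 - q * A * C) * (1 - q * C) ^ 4 * zhaoKappa q A (q ^ 2 * C) * (1 - A ^ 2 * C) -
        (q * C - A) * (1 - C) * zhaoKappa q A C * (1 - q ^ 2 * A * C) ^ 4 =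
      (1 - q) * ((q * C - A) * C * (1 - q ^ 3 * A * C ^ 2) * (1 - q ^ 2 * A ^ 2 * C) *
          (1 - q * A * C) * (1 - q * A) ^ 5 * (1 - A ^ 2 * C) -
        q * C * (1 - q * A * C ^ 2) * (1 - A ^ 2) * (1 - A) ^ 4 * (1 + q * A) *
          (1 - q ^ 2 * A * C) ^ 4) := by
  unfold zhaoKappa
  ring

theorem zhaoRat_closed (hq : q ≠ 0) (hq' : 1 - q ≠ 0) (hC : C ≠ 0) (hA : 1 + q * A ≠ 0)
    (hAC : 1 - A ^ 2 * C ≠ 0) (hAC' : 1 - q ^ 2 * A * C ≠ 0) :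
    zhaoHorShiftRat q A C - zhaoHorRat q A C * (1 - A / (q * C)) =
      zhaoVertShiftRat q A C * (1 - A / (q * C)) - zhaoVertRat q A C := by
  have hpoly := zhaoKappa_identity q A C
  rw [one_sub_div (mul_ne_zero hq hC)]
  unfold zhaoHorShiftRat zhaoHorRat zhaoVertShiftRat zhaoVertRat
  generalize zhaoKappa q A (q ^ 2 * C) = κ₁ at *
  generalize zhaoKappa q A C = κ₂ at *
  generalize q * C - A = d at *
  generalize 1 - q = y₁ at *
  generalize 1 + q * A = y₂ at *
  generalize 1 - A ^ 2 * C = y₃ at *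
  generalize 1 - q ^ 2 * A * C = y₄ at *
  generalize 1 - q * A * C = y₅ at *
  generalize 1 - q * C = y₆ at *
  generalize 1 - q ^ 3 * A * C ^ 2 = y₇ at *
  generalize 1 - q ^ 2 * A ^ 2 * C = y₈ at *
  generalize 1 - q * A = y₉ at *
  generalize 1 - q * A * C ^ 2 = z₁ at *
  generalize 1 - A ^ 2 = z₂ at *
  generalize 1 - A = z₃ at *
  generalize 1 - C = z₄ at *
  field_simp
  linear_combination hpoly

theorem zhaoHorRat_self {X : F} (q : F) (hX : 1 + X + X ^ 2 ≠ 0) :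
    zhaoHorRat q X X = zhaoKappa q X X / ((1 - q) * (1 + X + X ^ 2) * (1 + q * X)) := by
  rcases eq_or_ne X 1 with rfl | hX₁
  · simp [zhaoHorRat, zhaoKappa]
  · replace hX₁ : 1 - X ≠ 0 := sub_ne_zero.2 hX₁.symm
    rw [zhaoHorRat, show 1 - X ^ 2 * X = (1 - X) * (1 + X + X ^ 2) by ring]
    generalize 1 + X + X ^ 2 = y₁ at *
    generalize 1 - X = y₂ at *
    field_simp

theorem zhaoHorRat_add_zhaoVertShiftRat_self {X : F} (hq : 1 - q ≠ 0) (hX : 1 - q * X ≠ 0)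
    (hX' : 1 + q * X ≠ 0) (hX'' : 1 + X + X ^ 2 ≠ 0) :
    (1 - q) * (zhaoHorRat q X X + zhaoVertShiftRat q X X) =
      ((1 - q) * (X * (1 - q ^ 2 * X ^ 3) * (1 - q * X ^ 2) * (1 - q * X) * (1 - q ^ 3 * X ^ 3) *
          (1 + X + X ^ 2)) + (1 + q * X) ^ 4 * zhaoKappa q X X) /
        ((1 + X + X ^ 2) * (1 + q * X) ^ 5) := by
  rw [zhaoHorRat_self q hX'', zhaoVertShiftRat,
    show 1 - q ^ 2 * X * X = (1 - q * X) * (1 + q * X) by ring,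
    show q ^ 3 * X * X ^ 2 = q ^ 3 * X ^ 3 by ring, show q ^ 2 * X ^ 2 * X = q ^ 2 * X ^ 3 by ring,
    show q * X * X = q * X ^ 2 by ring]
  generalize zhaoKappa q X X = κ
  generalize 1 + X + X ^ 2 = y₁ at *
  generalize 1 + q * X = y₂ at *
  generalize 1 - q * X = y₃ at *
  generalize 1 - q = y₄ at *
  field_simp
  ring

end RationalFunctions

/-- The product underlying `zhaoHor` and `zhaoVert`. -/
noncomputable def zhaoKernel (q : ℝ) (a c : ℕ) : ℝ :=
  (-1) ^ c * (q ^ (2 * a * c) / q ^ c ^ 2) * qPoch (q ^ 2) (q ^ 2) (2 * a + c) *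
      qPoch q (q ^ 2) (a + c) * qPoch q (q ^ 2) a ^ 6 * qPoch q (q ^ 2) c ^ 4 /
    (qPoch (q ^ 2) (q ^ 2) c * qPoch (q ^ 2) (q ^ 2) (2 * a) * qPoch (q ^ 2) (q ^ 2) a ^ 4 *
      qPoch (q ^ 2) (q ^ 2) (a + c) ^ 4)

/-- The value of the closed form behind Zhao's series on the edge from `(a, c)` to `(a + 1, c)`.
The truncated subtraction is harmless, since the form is only considered for `c ≤ a`. -/
noncomputable def zhaoHor (q : ℝ) (a c : ℕ) : ℝ :=
  zhaoHorRat q (q ^ (2 * a)) (q ^ (2 * c)) * qPoch q (q ^ 2) (a - c) * zhaoKernel q a c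

/-- The value of the closed form behind Zhao's series on the edge from `(a, c)` to `(a, c + 1)`.
The truncated subtraction is harmless, since the form is only considered for `c < a`. -/
noncomputable def zhaoVert (q : ℝ) (a c : ℕ) : ℝ :=
  zhaoVertRat q (q ^ (2 * a)) (q ^ (2 * c)) * qPoch q (q ^ 2) (a - c - 1) * zhaoKernel q a c

theorem zhaoKernel_succ_right (q : ℝ) (a c : ℕ) :
    zhaoKernel q a (c + 1) =
      zhaoKernel q a c * zhaoKernelHorRatio q (q ^ (2 * a)) (q ^ (2 * c)) := by
  have hpow : q ^ (2 * a * (c + 1)) / q ^ (c + 1) ^ 2 =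
      q ^ (2 * a * c) / q ^ c ^ 2 * (q ^ (2 * a) / (q * q ^ (2 * c))) := by
    rw [div_mul_div_comm]
    congr 1 <;> ring
  unfold zhaoKernel zhaoKernelHorRatio
  rw [hpow]
  generalize q ^ (2 * a * c) / q ^ c ^ 2 = z
  generalize q ^ (2 * a) / (q * q ^ (2 * c)) = z'
  rw [div_mul_div_comm, ← add_assoc, ← add_assoc]
  simp only [qPoch_succ]
  congr 1 <;> ring

theorem zhaoKernel_succ_left (q : ℝ) (a c : ℕ) :
    zhaoKernel q (a + 1) c =
      zhaoKernel q a c * zhaoKernelVertRatio q (q ^ (2 * a)) (q ^ (2 * c)) := by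
  have hpow : q ^ (2 * (a + 1) * c) / q ^ c ^ 2 = q ^ (2 * a * c) / q ^ c ^ 2 * q ^ (2 * c) := by
    rw [div_mul_eq_mul_div]
    congr 1
    ring
  unfold zhaoKernel zhaoKernelVertRatio
  rw [hpow]
  generalize q ^ (2 * a * c) / q ^ c ^ 2 = z
  rw [div_mul_div_comm, show 2 * (a + 1) + c = 2 * a + c + 1 + 1 by ring, mul_add_one 2 a,
    add_right_comm a 1 c]
  simp only [qPoch_succ]
  congr 1 <;> ring

theorem zhaoHor_zero_right (q : ℝ) (a : ℕ) : zhaoHor q a 0 = 0 := by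
  simp [zhaoHor, zhaoHorRat]

variable {q : ℝ}

theorem zhaoHor_succ_right (hq : q ∈ Set.Ioo (0 : ℝ) 1) (a c : ℕ) :
    zhaoHor q a (c + 1) = zhaoHorShiftRat q (q ^ (2 * a)) (q ^ (2 * c)) *
      qPoch q (q ^ 2) (a - c - 1) * zhaoKernel q a c := by
  have hC : 1 - q ^ 2 * q ^ (2 * c) ≠ 0 := by
    rw [← pow_add]; exact (one_sub_pow_pos hq (by positivity)).ne'
  have hAC : 1 - q ^ 2 * (q ^ (2 * a)) ^ 2 * q ^ (2 * c) ≠ 0 := by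
    rw [← pow_mul, ← pow_add, ← pow_add]; exact (one_sub_pow_pos hq (by positivity)).ne'
  rw [zhaoHor, zhaoKernel_succ_right, Nat.sub_add_eq, mul_add_one 2 c, add_comm (2 * c), pow_add,
    ← zhaoHorRat_mul_zhaoKernelHorRatio hC hAC]
  ring

theorem zhaoVert_succ_left (hq : q ∈ Set.Ioo (0 : ℝ) 1) (a c : ℕ) :
    zhaoVert q (a + 1) c = zhaoVertShiftRat q (q ^ (2 * a)) (q ^ (2 * c)) *
      qPoch q (q ^ 2) (a - c) * zhaoKernel q a c := by
  have hA : 1 - q * q ^ (2 * a) ≠ 0 := by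
    rw [← pow_succ']; exact (one_sub_pow_pos hq (by positivity)).ne'
  have hA' : 1 - q ^ 2 * q ^ (2 * a) ≠ 0 := by
    rw [← pow_add]; exact (one_sub_pow_pos hq (by positivity)).ne'
  have hA'' : 1 - q ^ 4 * (q ^ (2 * a)) ^ 2 ≠ 0 := by
    rw [← pow_mul, ← pow_add]; exact (one_sub_pow_pos hq (by positivity)).ne'
  have hAC : 1 - q ^ 4 * (q ^ (2 * a)) ^ 2 * q ^ (2 * c) ≠ 0 := by
    rw [← pow_mul, ← pow_add, ← pow_add]; exact (one_sub_pow_pos hq (by positivity)).ne'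
  rw [zhaoVert, zhaoKernel_succ_left, Nat.sub_right_comm, Nat.add_sub_cancel, mul_add_one 2 a,
    add_comm (2 * a), pow_add, ← zhaoVertRat_mul_zhaoKernelVertRatio hA hA' hA'' hAC]
  ring

theorem zhao_closed (hq : q ∈ Set.Ioo (0 : ℝ) 1) {a c : ℕ} (hca : c < a) :
    zhaoHor q a (c + 1) - zhaoHor q a c = zhaoVert q (a + 1) c - zhaoVert q a c := by
  have hq₀ := hq.1
  have hAC : 1 - (q ^ (2 * a)) ^ 2 * q ^ (2 * c) ≠ 0 := by
    rw [← pow_mul, ← pow_add]; exact (one_sub_pow_pos hq (by omega)).ne'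
  have hAC' : 1 - q ^ 2 * q ^ (2 * a) * q ^ (2 * c) ≠ 0 := by
    rw [← pow_add, ← pow_add]; exact (one_sub_pow_pos hq (by positivity)).ne'
  have hqPoch : qPoch q (q ^ 2) (a - c) =
      qPoch q (q ^ 2) (a - c - 1) * (1 - q ^ (2 * a) / (q * q ^ (2 * c))) := by
    obtain ⟨m, rfl⟩ := Nat.exists_eq_add_of_lt hca
    rw [add_assoc, Nat.add_sub_cancel_left, Nat.add_sub_cancel, qPoch_succ]
    congr 2
    field_simp
    ring
  rw [zhaoHor_succ_right hq, zhaoVert_succ_left hq, zhaoHor, zhaoVert, hqPoch]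
  linear_combination qPoch q (q ^ 2) (a - c - 1) * zhaoKernel q a c *
    zhaoRat_closed hq₀.ne' (sub_pos.2 hq.2).ne' (pow_pos hq₀ (2 * c)).ne'
      (by positivity : 1 + q * q ^ (2 * a) ≠ 0) hAC hAC'

theorem zhaoPoly_eq (q : ℝ) {n : ℕ} {X : ℝ} (hX : X = q ^ (2 * n)) :
    (1 - q) * zhaoPoly q n =
      (1 - q) * (X * (1 - q ^ 2 * X ^ 3) * (1 - q * X ^ 2) * (1 - q * X) * (1 - q ^ 3 * X ^ 3) *
        (1 + X + X ^ 2)) + (1 + q * X) ^ 4 * zhaoKappa q X X := by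
  unfold zhaoPoly zhaoKappa
  rw [hX]
  ring

theorem zhaoKernel_self (hq : q ≠ 0) (n : ℕ) :
    zhaoKernel q n n =
      (-1) ^ n * q ^ n ^ 2 * qPoch q (q ^ 2) (2 * n) * qPoch (q ^ 2) (q ^ 2) (3 * n) *
          qPoch q (q ^ 2) n ^ 10 /
        (qPoch (q ^ 2) (q ^ 2) n ^ 5 * qPoch (q ^ 2) (q ^ 2) (2 * n) ^ 5) := by
  have hpow : q ^ (2 * n * n) / q ^ n ^ 2 = q ^ n ^ 2 := by
    rw [div_eq_iff (pow_ne_zero _ hq)]; ring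
  rw [zhaoKernel, hpow, ← two_mul n, show 2 * n + n = 3 * n by ring]
  congr 1 <;> ring

theorem zhaoQTerm_eq (hq : q ∈ Set.Ioo (0 : ℝ) 1) (n : ℕ) :
    zhaoQTerm q n = zhaoHor q n n + zhaoVert q (n + 1) n := by
  have hq₀ := hq.1
  have hq' : 1 - q ≠ 0 := (sub_pos.2 hq.2).ne'
  have hX : 1 - q * q ^ (2 * n) ≠ 0 := by
    rw [← pow_succ']; exact (one_sub_pow_pos hq (by positivity)).ne'
  have hrat : zhaoHorRat q (q ^ (2 * n)) (q ^ (2 * n)) +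
      zhaoVertShiftRat q (q ^ (2 * n)) (q ^ (2 * n)) =
        zhaoPoly q n / ((q ^ (2 * n) - q ^ n + 1) * (q ^ (2 * n) + q ^ n + 1) *
          (q ^ (2 * n + 1) + 1) ^ 5) := by
    refine mul_left_cancel₀ hq' ?_
    rw [zhaoHorRat_add_zhaoVertShiftRat_self hq' hX (by positivity) (by positivity),
      ← zhaoPoly_eq q rfl, ← mul_div_assoc]
    congr 1
    ring
  rw [zhaoVert_succ_left hq, zhaoHor, Nat.sub_self, qPoch_zero, mul_one, mul_one, ← add_mul, hrat,
    zhaoKernel_self hq₀.ne', zhaoQTerm, div_mul_div_comm]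
  congr 1 <;> ring

theorem abs_zhaoKernel_le (hq : q ∈ Set.Ioo (0 : ℝ) 1) {a c m : ℕ} (hm : m + c ^ 2 ≤ 2 * a * c) :
    |zhaoKernel q a c| ≤ q ^ m / qPochInf (q ^ 2) (q ^ 2) ^ 10 := by
  have hq₀ := hq.1
  have hodd := qPoch_odd_pos hq
  have heven := qPoch_even_pos hq
  have hinf := qPochInf_even_pos hq
  have hle := qPochInf_even_le hq
  have hpow : q ^ (2 * a * c) / q ^ c ^ 2 ≤ q ^ m := by
    rw [div_le_iff₀ (by positivity), ← pow_add]
    exact pow_le_pow_of_le_one hq₀.le hq.2.le hm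
  have := hodd a; have := hodd c; have := hodd (a + c)
  have := heven a; have := heven c; have := heven (a + c)
  have := heven (2 * a); have := heven (2 * a + c)
  rw [zhaoKernel, mul_assoc, mul_assoc, mul_assoc, mul_assoc, mul_div_assoc, abs_mul,
    abs_neg_one_pow, one_mul, abs_of_pos (by positivity)]
  calc _ ≤ q ^ m * (1 * (1 * (1 ^ 6 * 1 ^ 4))) /
        (qPochInf (q ^ 2) (q ^ 2) * qPochInf (q ^ 2) (q ^ 2) * qPochInf (q ^ 2) (q ^ 2) ^ 4 *
          qPochInf (q ^ 2) (q ^ 2) ^ 4) := by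
        gcongr
        exacts [qPoch_even_le_one hq _, qPoch_odd_le_one hq _, qPoch_odd_le_one hq _,
          qPoch_odd_le_one hq _, hle _, hle _, hle _, hle _]
    _ = _ := by ring

theorem abs_mul_qPoch_mul_zhaoKernel_le (hq : q ∈ Set.Ioo (0 : ℝ) 1) {r M : ℝ} (hr : |r| ≤ M)
    (k : ℕ) {a c m : ℕ} (hm : m + c ^ 2 ≤ 2 * a * c) :
    |r * qPoch q (q ^ 2) k * zhaoKernel q a c| ≤
      M / qPochInf (q ^ 2) (q ^ 2) ^ 10 * q ^ m := by
  have hM : 0 ≤ M := (abs_nonneg r).trans hr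
  rw [abs_mul, abs_mul, abs_of_pos (qPoch_odd_pos hq k)]
  calc _ ≤ M * 1 * (q ^ m / qPochInf (q ^ 2) (q ^ 2) ^ 10) := by
        gcongr
        exacts [(qPoch_odd_pos hq k).le, qPoch_odd_le_one hq k, abs_zhaoKernel_le hq hm]
    _ = _ := by ring

theorem continuousOn_zhaoVertRat (hq : q < 1) :
    ContinuousOn (fun p : ℝ × ℝ => zhaoVertRat q p.1 p.2) (Set.Icc 0 q ×ˢ Set.Icc 0 1) := by
  unfold zhaoVertRat
  refine ContinuousOn.div (by fun_prop) (by fun_prop) fun p hp => ?_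
  obtain ⟨⟨hA₀, hA⟩, _, hC⟩ := hp
  have hA₁ : p.1 ^ 2 < 1 := pow_lt_one₀ hA₀ (hA.trans_lt hq) two_ne_zero
  exact (sub_pos.2 ((mul_le_of_le_one_right (sq_nonneg _) hC).trans_lt hA₁)).ne'

theorem exists_abs_zhaoVert_le (hq : q ∈ Set.Ioo (0 : ℝ) 1) :
    ∃ K : ℝ, ∀ a c m : ℕ, a ≠ 0 → m + c ^ 2 ≤ 2 * a * c → |zhaoVert q a c| ≤ K * q ^ m := by
  obtain ⟨M, hM⟩ := (isCompact_Icc.prod isCompact_Icc).exists_bound_of_continuousOn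
    (continuousOn_zhaoVertRat hq.2)
  refine ⟨_, fun a c m ha hm => abs_mul_qPoch_mul_zhaoKernel_le hq
    (hM (q ^ (2 * a), q ^ (2 * c)) ⟨⟨(pow_mem_Icc hq _).1, ?_⟩, pow_mem_Icc hq _⟩) _ hm⟩
  exact pow_le_of_le_one hq.1.le hq.2.le (by positivity)

theorem summable_zhaoHor_self (hq : q ∈ Set.Ioo (0 : ℝ) 1) : Summable fun n => zhaoHor q n n := by
  have hcont : ContinuousOn (fun X => zhaoHorRat q X X) (Set.Icc 0 1) := by
    have hq₀ := hq.1
    have hq' := sub_pos.2 hq.2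
    refine ContinuousOn.congr
      (f := fun X => zhaoKappa q X X / ((1 - q) * (1 + X + X ^ 2) * (1 + q * X)))
      (ContinuousOn.div (by unfold zhaoKappa; fun_prop) (by fun_prop) fun X hX => ?_)
      fun X hX => zhaoHorRat_self q ?_
    all_goals
      have := hX.1
      positivity
  obtain ⟨M, hM⟩ := isCompact_Icc.exists_bound_of_continuousOn hcont
  refine Summable.of_norm_bounded ((summable_geometric_of_lt_one hq.1.le hq.2).mul_left _)
    fun n => abs_mul_qPoch_mul_zhaoKernel_le hq (hM _ (pow_mem_Icc hq (2 * n))) _ ?_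
  nlinarith [n.le_mul_self]

theorem zhaoKernel_zero_right (hq : q ∈ Set.Ioo (0 : ℝ) 1) (a : ℕ) :
    zhaoKernel q a 0 = qWallis q a ^ 7 / qPoch (q ^ 2) (q ^ 2) a := by
  have hne := (qPoch_even_pos hq (2 * a)).ne'
  simp only [zhaoKernel, qWallis, qPoch_zero, mul_zero, add_zero, pow_zero, zero_pow two_ne_zero]
  field_simp

theorem tendsto_zhaoVert_zero_right (hq : q ∈ Set.Ioo (0 : ℝ) 1) :
    Tendsto (fun a => zhaoVert q a 0) atTop (𝓝 (qWallisInf q ^ 8)) := by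
  have hQ : |q ^ 2| < 1 := by rw [abs_of_pos (sq_mem_Ioo hq).1]; exact (sq_mem_Ioo hq).2
  have hrat : Tendsto (fun a : ℕ => zhaoVertRat q (q ^ (2 * a)) 1) atTop (𝓝 1) := by
    have hcont : ContinuousAt (fun A => zhaoVertRat q A 1) 0 := by
      unfold zhaoVertRat
      exact ContinuousAt.div (by fun_prop) (by fun_prop) (by simp)
    have hone : zhaoVertRat q 0 1 = 1 := by simp [zhaoVertRat]
    rw [ContinuousAt, hone] at hcont
    exact hcont.comp (tendsto_pow_two_mul_atTop hq)
  have hpred : Tendsto (fun a => qPoch q (q ^ 2) (a - 0 - 1)) atTop (𝓝 (qPochInf q (q ^ 2))) :=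
    (tendsto_qPoch q hQ).comp (tendsto_sub_atTop_nat 1)
  have hker : Tendsto (fun a => qWallis q a ^ 7 / qPoch (q ^ 2) (q ^ 2) a) atTop
      (𝓝 (qWallisInf q ^ 7 / qPochInf (q ^ 2) (q ^ 2))) :=
    ((tendsto_qWallis hq).pow 7).div (tendsto_qPoch (q ^ 2) hQ) (qPochInf_even_pos hq).ne'
  have hlim : 1 * qPochInf q (q ^ 2) * (qWallisInf q ^ 7 / qPochInf (q ^ 2) (q ^ 2)) =
      qWallisInf q ^ 8 := by
    rw [qWallisInf]; ring
  rw [← hlim]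
  simpa only [zhaoVert, mul_zero, pow_zero, zhaoKernel_zero_right hq] using
    (hrat.mul hpred).mul hker

theorem hasSum_zhaoQTerm (hq : q ∈ Set.Ioo (0 : ℝ) 1) :
    HasSum (zhaoQTerm q) (qWallisInf q ^ 8) := by
  obtain ⟨K, hK⟩ := exists_abs_zhaoVert_le hq
  have hexponent : ∀ {N b : ℕ}, 0 < b → b < N → N + b ^ 2 ≤ 2 * N * b := fun {N b} hb hbN => by
    have h₁ : N ≤ N * b := Nat.le_mul_of_pos_right N hb
    have h₂ : b ^ 2 ≤ N * b := by rw [sq]; gcongr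
    linarith
  rw [funext (zhaoQTerm_eq hq)]
  exact hasSum_staircase (V := zhaoVert q) hq.1.le hq.2 (zhaoHor_zero_right q)
    (fun a c hca => zhao_closed hq hca) (summable_zhaoHor_self hq)
    (fun N b hb hbN => hK N b N (hb.trans hbN).ne' (hexponent hb hbN))
    (tendsto_zhaoVert_zero_right hq)

end ZhaoForm

section RisingFactorial

theorem risingFac_zero (a : ℝ) : risingFac a 0 = 1 := by
  rw [risingFac, ascPochhammer_zero, Polynomial.eval_one]

theorem risingFac_succ (a : ℝ) (n : ℕ) : risingFac a (n + 1) = risingFac a n * (a + n) :=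
  ascPochhammer_succ_eval n a

theorem risingFac_pos {a : ℝ} (ha : 0 < a) (n : ℕ) : 0 < risingFac a n :=
  ascPochhammer_pos n a ha

theorem risingFac_add (a : ℝ) (m n : ℕ) :
    risingFac a (m + n) = risingFac a m * ∏ j ∈ Finset.range n, (a + m + j) := by
  induction n with
  | zero => simp
  | succ n ih =>
    rw [← add_assoc, risingFac_succ, ih, Finset.prod_range_succ, mul_assoc, Nat.cast_add, add_assoc]

theorem risingFac_mul (a : ℝ) (m n : ℕ) :
    risingFac a (m * n) = m ^ (m * n) * ∏ j ∈ Finset.range m, risingFac ((a + j) / m) n := by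
  induction n with
  | zero => simp [risingFac_zero]
  | succ n ih =>
    have hfactor : ∏ j ∈ Finset.range m, (a + ↑(m * n) + j) =
        m ^ m * ∏ j ∈ Finset.range m, ((a + j) / m + n) := by
      calc ∏ j ∈ Finset.range m, (a + ↑(m * n) + j)
          = ∏ j ∈ Finset.range m, m * ((a + j) / m + n) := by
            refine Finset.prod_congr rfl fun j hj => ?_
            have hm : (m : ℝ) ≠ 0 := Nat.cast_ne_zero.2 (Nat.ne_zero_of_lt (Finset.mem_range.1 hj))
            push_cast
            field_simp
            ring
        _ = m ^ m * ∏ j ∈ Finset.range m, ((a + j) / m + n) := by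
            rw [Finset.prod_mul_distrib, Finset.prod_const, Finset.card_range]
    simp only [risingFac_succ, Finset.prod_mul_distrib]
    rw [mul_add_one, risingFac_add, ih, hfactor]
    ring

theorem risingFac_one_two_mul (n : ℕ) :
    risingFac 1 (2 * n) = 2 ^ (2 * n) * (risingFac (1 / 2) n * risingFac 1 n) := by
  rw [risingFac_mul]
  norm_num [Finset.prod_range_succ]

theorem risingFac_one_half_two_mul (n : ℕ) :
    risingFac (1 / 2) (2 * n) = 2 ^ (2 * n) * (risingFac (1 / 4) n * risingFac (3 / 4) n) := by
  rw [risingFac_mul]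
  norm_num [Finset.prod_range_succ]

theorem risingFac_one_three_mul (n : ℕ) :
    risingFac 1 (3 * n) =
      3 ^ (3 * n) * (risingFac (1 / 3) n * risingFac (2 / 3) n * risingFac 1 n) := by
  rw [risingFac_mul]
  norm_num [Finset.prod_range_succ]

theorem risingFac_one_four_mul (n : ℕ) :
    risingFac 1 (4 * n) =
      4 ^ (4 * n) * (risingFac (1 / 4) n * risingFac (1 / 2) n * risingFac (3 / 4) n *
        risingFac 1 n) := by
  rw [risingFac_mul]
  norm_num [Finset.prod_range_succ]

end RisingFactorial

section TermwiseLimits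

theorem eventually_one_sub_pow_ne_zero {m : ℕ} (hm : m ≠ 0) :
    ∀ᶠ q : ℝ in 𝓝[≠] 1, 1 - q ^ m ≠ 0 := by
  filter_upwards [self_mem_nhdsWithin, mem_nhdsWithin_of_mem_nhds (lt_mem_nhds one_pos)]
    with q hq hq₀ h
  exact hq ((pow_eq_one_iff_of_nonneg (le_of_lt hq₀) hm).1 (sub_eq_zero.1 h).symm)

theorem tendsto_nhdsNE_of_continuous {f : ℝ → ℝ} (hf : Continuous f) {y : ℝ} (hy : f 1 = y) :
    Tendsto f (𝓝[≠] 1) (𝓝 y) :=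
  (hf.tendsto' 1 y hy).mono_left nhdsWithin_le_nhds

theorem tendsto_one_sub_pow_div (j : ℕ) {m : ℕ} (hm : m ≠ 0) :
    Tendsto (fun q : ℝ => (1 - q ^ j) / (1 - q ^ m)) (𝓝[≠] 1) (𝓝 (j / m)) := by
  have hgeom (k : ℕ) :
      Tendsto (fun q : ℝ => ∑ i ∈ Finset.range k, q ^ i) (𝓝[≠] 1) (𝓝 k) :=
    tendsto_nhdsNE_of_continuous (by fun_prop) (by simp)
  refine ((hgeom j).div (hgeom m) (Nat.cast_ne_zero.2 hm)).congr' ?_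
  filter_upwards [self_mem_nhdsWithin] with q hq
  rw [Pi.div_apply, ← mul_neg_geom_sum, ← mul_neg_geom_sum,
    mul_div_mul_left _ _ (sub_ne_zero.2 (Ne.symm hq))]

theorem tendsto_qPoch_div_pow (i : ℕ) {m : ℕ} (hm : m ≠ 0) (n : ℕ) :
    Tendsto (fun q : ℝ => qPoch (q ^ i) (q ^ m) n / (1 - q ^ m) ^ n) (𝓝[≠] 1)
      (𝓝 (risingFac (i / m) n)) := by
  induction n with
  | zero => simp [qPoch_zero, risingFac_zero]
  | succ n ih =>
    have hm' : (m : ℝ) ≠ 0 := Nat.cast_ne_zero.2 hm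
    have harg : (i / m + n : ℝ) = (i + m * n : ℕ) / m := by push_cast; field_simp
    rw [risingFac_succ, harg]
    refine (ih.mul (tendsto_one_sub_pow_div (i + m * n) hm)).congr fun q => ?_
    rw [qPoch_succ, div_mul_div_comm, ← pow_succ, pow_add, pow_mul]

theorem tendsto_qPoch_odd_div_pow (n : ℕ) :
    Tendsto (fun q : ℝ => qPoch q (q ^ 2) n / (1 - q ^ 2) ^ n) (𝓝[≠] 1)
      (𝓝 (risingFac (1 / 2) n)) := by
  simpa using tendsto_qPoch_div_pow 1 two_ne_zero n

theorem tendsto_qPoch_even_div_pow (n : ℕ) :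
    Tendsto (fun q : ℝ => qPoch (q ^ 2) (q ^ 2) n / (1 - q ^ 2) ^ n) (𝓝[≠] 1)
      (𝓝 (risingFac 1 n)) := by
  simpa using tendsto_qPoch_div_pow 2 two_ne_zero n

theorem cullenTheta_eq {R : Type*} [CommRing R] (U W : R) :
    cullenTheta U W = 2 * ((1 - U) + (1 - W)) ^ 2 - 2 * (1 - U) * (1 - W) -
      3 * ((1 - U) + (1 - W)) * (1 - U) * (1 - W) + (1 - U) ^ 2 * (1 - W) ^ 2 := by
  unfold cullenTheta
  ring

theorem tendsto_cullenTheta_div (i j : ℕ) :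
    Tendsto (fun q : ℝ => cullenTheta (q ^ i) (q ^ j) / (1 - q ^ 2) ^ 2) (𝓝[≠] 1)
      (𝓝 (((i : ℝ) ^ 2 + i * j + j ^ 2) / 2)) := by
  have hi := tendsto_one_sub_pow_div i two_ne_zero
  have hj := tendsto_one_sub_pow_div j two_ne_zero
  have hi₀ : Tendsto (fun q : ℝ => 1 - q ^ i) (𝓝[≠] 1) (𝓝 0) :=
    tendsto_nhdsNE_of_continuous (by fun_prop) (by simp)
  have hj₀ : Tendsto (fun q : ℝ => 1 - q ^ j) (𝓝[≠] 1) (𝓝 0) :=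
    tendsto_nhdsNE_of_continuous (by fun_prop) (by simp)
  have hlim := ((((hi.add hj).pow 2).const_mul 2).sub ((hi.mul hj).const_mul 2)).sub
    (((hi₀.add hj₀).mul (hi.mul hj)).const_mul 3) |>.add ((hi.mul hj).mul (hi₀.mul hj₀))
  convert hlim using 2 with q
  · rw [cullenTheta_eq]
    generalize 1 - q ^ 2 = d
    ring
  · push_cast; ring

theorem tendsto_cullenPoly_div (n : ℕ) :
    Tendsto (fun q : ℝ => cullenPoly q n / (1 - q ^ 2) ^ 4) (𝓝[≠] 1)
      (𝓝 ((43680 * (n : ℝ) ^ 4 + 20632 * n ^ 3 + 4340 * n ^ 2 + 466 * n + 21) / 2)) := by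
  have hcont₁ : Tendsto (fun q : ℝ => (1 + q ^ (2 * n + 1)) ^ 8) (𝓝[≠] 1) (𝓝 256) :=
    tendsto_nhdsNE_of_continuous (by fun_prop) (by norm_num)
  have hcont₂ : Tendsto (fun q : ℝ => q ^ (4 * n) * (1 + q ^ (4 * n))) (𝓝[≠] 1) (𝓝 2) :=
    tendsto_nhdsNE_of_continuous (by fun_prop) (by norm_num)
  have hlin (j : ℕ) := tendsto_one_sub_pow_div j two_ne_zero
  have hlim := ((((hlin (4 * n)).mul (hlin (6 * n + 1))).mul
    (tendsto_cullenTheta_div (4 * n) (2 * n + 1))).mul hcont₁).add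
    (((hcont₂.mul (hlin (8 * n + 2))).mul (hlin (6 * n + 3))).mul
      (tendsto_cullenTheta_div (4 * n + 2) (2 * n + 1)))
  convert hlim using 2 with q
  · rw [cullenPoly_eq q rfl, show (q ^ (2 * n)) ^ 2 = q ^ (4 * n) by ring,
      show q * q ^ (2 * n) = q ^ (2 * n + 1) by ring,
      show q ^ 2 * q ^ (4 * n) = q ^ (4 * n + 2) by ring]
    generalize cullenTheta (q ^ (4 * n)) (q ^ (2 * n + 1)) = t₁
    generalize cullenTheta (q ^ (4 * n + 2)) (q ^ (2 * n + 1)) = t₂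
    generalize (1 - q ^ 2) = d
    ring
  · push_cast; ring

theorem tendsto_zhaoKappa_self_div (n : ℕ) :
    Tendsto (fun q : ℝ => zhaoKappa q (q ^ (2 * n)) (q ^ (2 * n)) / (1 - q ^ 2) ^ 5) (𝓝[≠] 1)
      (𝓝 ((3 * (4 * (n : ℝ) + 1) ^ 2 * n * (2 * n + 1) ^ 2 - 32 * (6 * n + 1) * n ^ 4) / 16)) := by
  have hcont : Tendsto (fun q : ℝ => q * (1 + q ^ (2 * n + 1))) (𝓝[≠] 1) (𝓝 2) :=
    tendsto_nhdsNE_of_continuous (by fun_prop) (by norm_num)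
  have hlin (j : ℕ) := tendsto_one_sub_pow_div j two_ne_zero
  have hlim := ((((hlin (4 * n + 1)).pow 2).mul (hlin (6 * n))).mul ((hlin (2 * n + 1)).pow 2)).sub
    (((hcont.mul (hlin (6 * n + 1))).mul ((hlin (2 * n)).pow 3)).mul (hlin (4 * n)))
  convert hlim using 2 with q
  · rw [zhaoKappa]
    generalize (1 - q ^ 2) = d
    ring
  · push_cast; ring

theorem tendsto_zhaoPoly_div (n : ℕ) :
    Tendsto (fun q : ℝ => zhaoPoly q n / (1 - q ^ 2) ^ 4) (𝓝[≠] 1)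
      (𝓝 ((4528 * (n : ℝ) ^ 4 + 3180 * n ^ 3 + 972 * n ^ 2 + 147 * n + 9) / 8)) := by
  have hcont₁ : Tendsto (fun q : ℝ => q ^ (2 * n) * (1 + q ^ (2 * n) + q ^ (4 * n))) (𝓝[≠] 1)
      (𝓝 3) :=
    tendsto_nhdsNE_of_continuous (by fun_prop) (by norm_num)
  have hcont₂ : Tendsto (fun q : ℝ => (1 + q ^ (2 * n + 1)) ^ 4) (𝓝[≠] 1) (𝓝 16) :=
    tendsto_nhdsNE_of_continuous (by fun_prop) (by norm_num)
  have hlin (j : ℕ) := tendsto_one_sub_pow_div j two_ne_zero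
  have hlim := ((((hcont₁.mul (hlin (6 * n + 2))).mul (hlin (4 * n + 1))).mul
    (hlin (2 * n + 1))).mul (hlin (6 * n + 3))).add
    ((hcont₂.mul (tendsto_zhaoKappa_self_div n)).div (hlin 1) (by norm_num))
  refine (hlim.congr' ?_).trans_eq (congrArg 𝓝 ?_)
  · filter_upwards [eventually_one_sub_pow_ne_zero one_ne_zero,
      eventually_one_sub_pow_ne_zero two_ne_zero] with q hq hq'
    have hpoly := zhaoPoly_eq q (n := n) rfl
    simp only [Pi.div_apply, pow_one] at hq ⊢
    rw [eq_div_iff (pow_ne_zero 4 hq'), ← mul_right_inj' hq, hpoly]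
    generalize zhaoKappa q (q ^ (2 * n)) (q ^ (2 * n)) = κ
    generalize 1 - q ^ 2 = d at hq'
    field_simp
    ring
  · push_cast; ring

theorem cullenTerm_div_eq (n : ℕ) :
    cullenTerm n / 2048 =
      (43680 * (n : ℝ) ^ 4 + 20632 * n ^ 3 + 4340 * n ^ 2 + 466 * n + 21) / 2 *
        risingFac 1 (4 * n) * risingFac (1 / 2) n ^ 16 / (2 ^ 10 * risingFac 1 (2 * n) ^ 10) := by
  have h₁ := (risingFac_pos one_pos n).ne'
  have h₂ := (risingFac_pos one_half_pos n).ne'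
  have hpow : (4 : ℝ) ^ (4 * n) = 2 ^ (8 * n) := by
    rw [show (4 : ℝ) = 2 ^ 2 by norm_num, ← pow_mul]; ring_nf
  rw [cullenTerm, risingFac_one_four_mul, risingFac_one_two_mul, hpow, one_div_pow, ← pow_mul]
  field_simp
  ring

theorem zhaoTerm_div_eq (n : ℕ) :
    zhaoTerm n / 768 =
      (-1) ^ n * ((4528 * (n : ℝ) ^ 4 + 3180 * n ^ 3 + 972 * n ^ 2 + 147 * n + 9) / 8) *
        risingFac (1 / 2) (2 * n) * risingFac 1 (3 * n) * risingFac (1 / 2) n ^ 10 /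
        (3 * 2 ^ 5 * risingFac 1 n ^ 5 * risingFac 1 (2 * n) ^ 5) := by
  have h₁ := (risingFac_pos one_pos n).ne'
  have h₂ := (risingFac_pos one_half_pos n).ne'
  rw [zhaoTerm, risingFac_one_three_mul, risingFac_one_two_mul, risingFac_one_half_two_mul,
    neg_pow, div_pow, ← pow_mul, ← pow_mul]
  field_simp
  ring

theorem tendsto_cullenQTerm_div (n : ℕ) :
    Tendsto (fun q : ℝ => cullenQTerm q n / (1 - q ^ 2) ^ 4) (𝓝[≠] 1)
      (𝓝 (cullenTerm n / 2048)) := by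
  have hgauss : Tendsto (fun q : ℝ => q ^ (4 * n ^ 2)) (𝓝[≠] 1) (𝓝 1) :=
    tendsto_nhdsNE_of_continuous (by fun_prop) (one_pow _)
  have hden : Tendsto (fun q : ℝ => (q ^ (4 * n) + 1) * (q ^ (2 * n + 1) + 1) ^ 9) (𝓝[≠] 1)
      (𝓝 (2 ^ 10)) :=
    tendsto_nhdsNE_of_continuous (by fun_prop) (by norm_num)
  have hlim := (((hgauss.mul (tendsto_cullenPoly_div n)).mul
    (tendsto_qPoch_even_div_pow (4 * n))).mul ((tendsto_qPoch_odd_div_pow n).pow 16)).div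
    (hden.mul ((tendsto_qPoch_even_div_pow (2 * n)).pow 10))
    (mul_ne_zero (by norm_num) (pow_ne_zero _ (risingFac_pos one_pos _).ne'))
  rw [one_mul, ← cullenTerm_div_eq] at hlim
  refine hlim.congr' ?_
  filter_upwards [eventually_one_sub_pow_ne_zero two_ne_zero] with q hq
  simp only [Pi.div_apply, cullenQTerm]
  generalize 1 - q ^ 2 = d at hq
  field_simp
  ring

theorem tendsto_zhaoQTerm_div (n : ℕ) :
    Tendsto (fun q : ℝ => zhaoQTerm q n / (1 - q ^ 2) ^ 4) (𝓝[≠] 1)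
      (𝓝 (zhaoTerm n / 768)) := by
  have hgauss : Tendsto (fun q : ℝ => (-1) ^ n * q ^ (n ^ 2)) (𝓝[≠] 1) (𝓝 ((-1) ^ n)) :=
    tendsto_nhdsNE_of_continuous (by fun_prop) (by simp)
  have hden : Tendsto (fun q : ℝ => (q ^ (2 * n) - q ^ n + 1) * (q ^ (2 * n) + q ^ n + 1) *
      (q ^ (2 * n + 1) + 1) ^ 5) (𝓝[≠] 1) (𝓝 (3 * 2 ^ 5)) :=
    tendsto_nhdsNE_of_continuous (by fun_prop) (by norm_num)
  have hlim := ((((hgauss.mul (tendsto_zhaoPoly_div n)).mul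
    (tendsto_qPoch_odd_div_pow (2 * n))).mul (tendsto_qPoch_even_div_pow (3 * n))).mul
    ((tendsto_qPoch_odd_div_pow n).pow 10)).div
    ((hden.mul ((tendsto_qPoch_even_div_pow n).pow 5)).mul
      ((tendsto_qPoch_even_div_pow (2 * n)).pow 5))
    (mul_ne_zero (mul_ne_zero (by norm_num) (pow_ne_zero _ (risingFac_pos one_pos _).ne'))
      (pow_ne_zero _ (risingFac_pos one_pos _).ne'))
  rw [← zhaoTerm_div_eq] at hlim
  refine hlim.congr' ?_
  filter_upwards [eventually_one_sub_pow_ne_zero two_ne_zero] with q hq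
  simp only [Pi.div_apply, zhaoQTerm]
  generalize 1 - q ^ 2 = d at hq
  generalize (-1) ^ n * q ^ n ^ 2 = g
  generalize (q ^ (2 * n) - q ^ n + 1) * (q ^ (2 * n) + q ^ n + 1) * (q ^ (2 * n + 1) + 1) ^ 5 = t
  field_simp
  ring

end TermwiseLimits

section QGammaLimit

variable {q : ℝ}

theorem one_sub_pow_mul_le_sq (hq : 0 ≤ q) (j : ℕ) :
    (1 - q ^ j) * (1 - q ^ (j + 2)) ≤ (1 - q ^ (j + 1)) ^ 2 := by
  rw [← sub_nonneg]
  calc (0 : ℝ) ≤ q ^ j * (1 - q) ^ 2 := mul_nonneg (pow_nonneg hq j) (sq_nonneg _)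
    _ = (1 - q ^ (j + 1)) ^ 2 - (1 - q ^ j) * (1 - q ^ (j + 2)) := by ring

theorem qWallis_succ (q : ℝ) (n : ℕ) :
    qWallis q (n + 1) = qWallis q n * ((1 - q ^ (2 * n + 1)) / (1 - q ^ (2 * n + 2))) := by
  rw [qWallis, qWallis, qPoch_succ, qPoch_succ, ← pow_mul, ← pow_succ', ← pow_add, add_comm 2,
    div_mul_div_comm]

theorem antitone_qWallis_sq_mul (hq : q ∈ Set.Ioo (0 : ℝ) 1) :
    Antitone fun n => qWallis q n ^ 2 * (1 - q ^ (2 * n + 1)) := by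
  refine antitone_nat_of_succ_le fun n => ?_
  have hpos : 0 < 1 - q ^ (2 * n + 2) := one_sub_pow_pos hq (by lia)
  have hodd : 0 < 1 - q ^ (2 * n + 1) := one_sub_pow_pos hq (by lia)
  calc qWallis q (n + 1) ^ 2 * (1 - q ^ (2 * (n + 1) + 1))
      = qWallis q n ^ 2 * (1 - q ^ (2 * n + 1)) *
          ((1 - q ^ (2 * n + 1)) * (1 - q ^ (2 * n + 1 + 2)) / (1 - q ^ (2 * n + 2)) ^ 2) := by
        rw [qWallis_succ, mul_add_one, add_right_comm]
        field_simp
    _ ≤ qWallis q n ^ 2 * (1 - q ^ (2 * n + 1)) :=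
        mul_le_of_le_one_right (mul_nonneg (sq_nonneg _) hodd.le)
          (div_le_one_of_le₀ (one_sub_pow_mul_le_sq hq.1.le (2 * n + 1)) (sq_nonneg _))

theorem monotone_qWallis_sq_mul (hq : q ∈ Set.Ioo (0 : ℝ) 1) :
    Monotone fun n => qWallis q n ^ 2 * (1 - q ^ (2 * n)) := by
  refine monotone_nat_of_le_succ fun n => ?_
  have hpos : 0 < 1 - q ^ (2 * n + 2) := one_sub_pow_pos hq (by lia)
  calc qWallis q n ^ 2 * (1 - q ^ (2 * n))
      ≤ qWallis q n ^ 2 * ((1 - q ^ (2 * n + 1)) ^ 2 / (1 - q ^ (2 * n + 2))) :=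
        mul_le_mul_of_nonneg_left
          ((le_div_iff₀ hpos).2 (one_sub_pow_mul_le_sq hq.1.le (2 * n))) (sq_nonneg _)
    _ = qWallis q (n + 1) ^ 2 * (1 - q ^ (2 * (n + 1))) := by
        rw [qWallis_succ, mul_add_one]
        field_simp

theorem tendsto_qWallis_sq_mul (hq : q ∈ Set.Ioo (0 : ℝ) 1) (j : ℕ) :
    Tendsto (fun n => qWallis q n ^ 2 * (1 - q ^ (2 * n + j))) atTop (𝓝 (qWallisInf q ^ 2)) := by
  have hlim := ((tendsto_qWallis hq).pow 2).mul
    (((tendsto_pow_two_mul_atTop hq).mul_const (q ^ j)).const_sub 1)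
  simpa only [pow_add, zero_mul, sub_zero, mul_one] using hlim

theorem qWallisInf_sq_mem_Icc (hq : q ∈ Set.Ioo (0 : ℝ) 1) (n : ℕ) :
    qWallisInf q ^ 2 ∈
      Set.Icc (qWallis q n ^ 2 * (1 - q ^ (2 * n))) (qWallis q n ^ 2 * (1 - q ^ (2 * n + 1))) :=
  ⟨(monotone_qWallis_sq_mul hq).ge_of_tendsto (tendsto_qWallis_sq_mul hq 0) n,
    (antitone_qWallis_sq_mul hq).le_of_tendsto (tendsto_qWallis_sq_mul hq 1) n⟩

theorem risingFac_one_half_sq_mul_W (n : ℕ) :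
    risingFac (1 / 2) n ^ 2 * (n + 1 / 2) * (2 * Real.Wallis.W n) = risingFac 1 n ^ 2 := by
  induction n with
  | zero => simp [risingFac_zero, Real.Wallis.W]
  | succ n ih =>
    rw [risingFac_succ, risingFac_succ, Real.Wallis.W_succ, mul_pow _ ((1 : ℝ) + n), ← ih]
    push_cast
    field_simp
    ring

theorem tendsto_risingFac_ratio_sq_mul_add_half :
    Tendsto (fun n : ℕ => (risingFac (1 / 2) n / risingFac 1 n) ^ 2 * (n + 1 / 2)) atTop
      (𝓝 (1 / Real.pi)) := by
  have hlim := (Real.Wallis.tendsto_W_nhds_pi_div_two.const_mul 2).inv₀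
    (mul_ne_zero two_ne_zero (half_pos Real.pi_pos).ne')
  rw [mul_div_cancel₀ _ two_ne_zero, ← one_div] at hlim
  refine hlim.congr fun n => ?_
  have h₁ := (risingFac_pos one_pos n).ne'
  have hW := (Real.Wallis.W_pos n).ne'
  rw [div_pow, inv_eq_iff_eq_inv, eq_comm, inv_eq_iff_eq_inv, div_mul_eq_mul_div,
    div_eq_iff (pow_ne_zero 2 h₁), ← risingFac_one_half_sq_mul_W]
  field_simp

theorem tendsto_risingFac_ratio_sq_mul :
    Tendsto (fun n : ℕ => (risingFac (1 / 2) n / risingFac 1 n) ^ 2 * n) atTop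
      (𝓝 (1 / Real.pi)) := by
  have hlim := tendsto_risingFac_ratio_sq_mul_add_half.mul
    (tendsto_natCast_div_add_atTop (1 / 2 : ℝ))
  rw [mul_one] at hlim
  refine hlim.congr fun n => ?_
  rw [mul_assoc, mul_div_cancel₀]
  positivity

theorem tendsto_qWallis_sq_mul_div (n j : ℕ) :
    Tendsto (fun q => qWallis q n ^ 2 * (1 - q ^ j) / (1 - q ^ 2)) (𝓝[≠] 1)
      (𝓝 ((risingFac (1 / 2) n / risingFac 1 n) ^ 2 * (j / 2))) := by
  have hlim := (((tendsto_qPoch_odd_div_pow n).div (tendsto_qPoch_even_div_pow n)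
    (risingFac_pos one_pos n).ne').pow 2).mul (tendsto_one_sub_pow_div j two_ne_zero)
  refine hlim.congr' ?_
  filter_upwards [eventually_one_sub_pow_ne_zero two_ne_zero] with q hq
  rw [Pi.div_apply, div_div_div_cancel_right₀ (pow_ne_zero n hq), qWallis, mul_div_assoc]

theorem tendsto_qWallisInf_sq_div :
    Tendsto (fun q => qWallisInf q ^ 2 / (1 - q ^ 2)) (𝓝[<] 1) (𝓝 (1 / Real.pi)) := by
  refine tendsto_of_forall_eventually_mem_Icc (p := atTop) (fun n => ?_)
    (fun n => (tendsto_qWallis_sq_mul_div n (2 * n)).mono_left (nhdsLT_le_nhdsNE 1))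
    (fun n => (tendsto_qWallis_sq_mul_div n (2 * n + 1)).mono_left (nhdsLT_le_nhdsNE 1)) ?_ ?_
  · filter_upwards [Ioo_mem_nhdsLT one_pos] with q hq
    have hpos := (one_sub_pow_pos hq two_ne_zero).le
    exact ⟨div_le_div_of_nonneg_right (qWallisInf_sq_mem_Icc hq n).1 hpos,
      div_le_div_of_nonneg_right (qWallisInf_sq_mem_Icc hq n).2 hpos⟩
  · simpa using tendsto_risingFac_ratio_sq_mul
  · simpa [add_div] using tendsto_risingFac_ratio_sq_mul_add_half

theorem tendsto_qGamma_sq_one_half :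
    Tendsto (fun q : ℝ => (1 - q ^ 2) ^ 4 / qGamma (q ^ 2) (1 / 2) ^ 8 / (1 - q ^ 2) ^ 4)
      (𝓝[<] 1) (𝓝 (1 / Real.pi ^ 4)) := by
  have hlim := tendsto_qWallisInf_sq_div.pow 4
  rw [one_div_pow] at hlim
  refine hlim.congr' ?_
  filter_upwards [Ioo_mem_nhdsLT one_pos] with q hq
  rw [one_sub_sq_pow_four_div_qGamma_pow_eight hq, div_pow, ← pow_mul]

end QGammaLimit

/-- The two `q`-series evaluations for `0 < q < 1`, together with the fact that, after division by
`(1 - q²)⁴`, both sides tend (the sums term by term) to Cullen's and Zhao's formulas for `1 / π⁴`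
as `q → 1⁻`. -/
theorem mainTheorem4 :
    (∀ q : ℝ, 0 < q → q < 1 →
      HasSum (cullenQTerm q) ((1 - q ^ 2) ^ 4 / qGamma (q ^ 2) (1 / 2) ^ 8) ∧
      HasSum (zhaoQTerm q) ((1 - q ^ 2) ^ 4 / qGamma (q ^ 2) (1 / 2) ^ 8)) ∧
    (∀ n : ℕ, Tendsto (fun q : ℝ => cullenQTerm q n / (1 - q ^ 2) ^ 4) (𝓝[<] 1)
      (𝓝 (cullenTerm n / 2048))) ∧
    (∀ n : ℕ, Tendsto (fun q : ℝ => zhaoQTerm q n / (1 - q ^ 2) ^ 4) (𝓝[<] 1)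
      (𝓝 (zhaoTerm n / 768))) ∧
    Tendsto (fun q : ℝ => (1 - q ^ 2) ^ 4 / qGamma (q ^ 2) (1 / 2) ^ 8 / (1 - q ^ 2) ^ 4)
      (𝓝[<] 1) (𝓝 (1 / Real.pi ^ 4)) := by
  refine ⟨fun q hq₀ hq₁ => ?_, fun n => ?_, fun n => ?_, tendsto_qGamma_sq_one_half⟩
  · rw [one_sub_sq_pow_four_div_qGamma_pow_eight ⟨hq₀, hq₁⟩]
    exact ⟨hasSum_cullenQTerm ⟨hq₀, hq₁⟩, hasSum_zhaoQTerm ⟨hq₀, hq₁⟩⟩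
  · exact (tendsto_cullenQTerm_div n).mono_left (nhdsLT_le_nhdsNE 1)
  · exact (tendsto_zhaoQTerm_div n).mono_left (nhdsLT_le_nhdsNE 1)
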